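/- For a partition $\lambda=(\lambda_1\ge\lambda_2\ge\cdots)$ let $l(\lambda)$ be its number of nonzero parts and $\lambda_{\mathrm o}$ the partition consisting of the odd parts of $\lambda$ (with multiplicity). For $n\ge 0$, $x=(x_1,\dots,x_n)$ and $l(\lambda)\le n$, the Hall–Littlewood polynomial is $$P_\lambda(x;t)=\sum_{w\in S_n/S_n^\lambda} w\Bigl(x_1^{\lambda_1}\cdots x_n^{\lambda_n}\prod_{\lambda_i>\lambda_j}\frac{x_i-tx_j}{x_i-x_j}\Bigr)\in\mathbb Z[t][x_1,\dots,x_n],$$ where $w$ acts by permuting the variables, $S_n^\lambda$ is the subgroup of $S_n$ fixing $(\lambda_1,\dots,\lambda_n)$ and the product is over $1\le i,j\le n$ with $\lambda_i>\lambda_j$; if $l(\lambda)>n$, then $P_\lambda(x;t)=0$. Since $P_\lambda(x_1,\dots,x_n,0;t)=P_\lambda(x_1,\dots,x_n;t)$, these polynomials determine the Hall–Littlewood symmetric function $P_\lambda(x;t)$ in infinitely many variables $x=(x_1,x_2,\dots)$, a formal power series over $\mathbb Z[t]$ that gives back $P_\lambda(x_1,\dots,x_n;t)$ when $x_i=0$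 for all $i>n$. Then the following holds as an identity of formal power series in $x$, with $a$ and $t$ indeterminates, or more generally arbitrary elements of a commutative ring, both for finitely many variables $x=(x_1,\dots,x_n)$, $n\ge 0$, and for infinitely many variables $x=(x_1,x_2,\dots)$: $$\sum_{\lambda} a^{l(\lambda_{\mathrm o})}P_\lambda(x;t)=\prod_{i\ge 1}\frac{1+ax_i}{1-x_i^2}\prod_{i<j}\frac{1-tx_ix_j}{1-x_ix_j},$$ where the sum is over all partitions $\lambda$, and the sum and the products converge coefficientwise. -/

import Mathlib

open scoped MvPowerSeries.WithPiTopology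

namespace HallLittlewood

/-- The length `l(μ)`: the number of nonzero parts. The `i`-th part (indexing from `0`) of the
partition `μ`, identified with its Young diagram, is `μ.rowLen i`. -/
def length (μ : YoungDiagram) : ℕ := μ.colLen 0

/-- The partition `μ_o` consisting of the odd parts of `μ`. -/
def oddParts (μ : YoungDiagram) : YoungDiagram :=
  YoungDiagram.ofRowLens (μ.rowLens.filter fun r => Odd r)
    (List.Pairwise.filter _ μ.rowLens_sorted.pairwise).sortedGE

noncomputable section

/-- The field of rational functions in `x₁, …, xₙ` over `ℤ[t]`. -/
abbrev RatFun (n : ℕ) : Type := FractionRing (MvPolynomial (Fin n) (Polynomial ℤ))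

/-- The variable `x i`. -/
def x {n : ℕ} (i : Fin n) : RatFun n :=
  algebraMap (MvPolynomial (Fin n) (Polynomial ℤ)) _ (MvPolynomial.X i)

/-- The parameter `t`. -/
def tt (n : ℕ) : RatFun n :=
  algebraMap (MvPolynomial (Fin n) (Polynomial ℤ)) _ (MvPolynomial.C Polynomial.X)

/-- The subgroup `S_n^μ` of permutations which leave `(μ₁, …, μₙ)` invariant. -/
def stab (n : ℕ) (μ : YoungDiagram) : Subgroup (Equiv.Perm (Fin n)) where
  carrier := {w | ∀ i, μ.rowLen (w i) = μ.rowLen i}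
  mul_mem' {v w} hv hw i := by
    have h1 := hv (w i)
    have h2 := hw i
    simp only [Equiv.Perm.mul_apply]
    exact h1.trans h2
  one_mem' i := rfl
  inv_mem' {w} hw i := by
    have h1 := hw (w⁻¹ i)
    simpa using h1.symm

/-- The image under the permutation `w` of the variables (`x i ↦ x (w i)`) of
`x^μ ∏_{μ_i > μ_j} (x_i - t x_j) / (x_i - x_j)`. -/
def term (n : ℕ) (μ : YoungDiagram) (w : Equiv.Perm (Fin n)) : RatFun n :=
  (∏ i : Fin n, x (w i) ^ μ.rowLen i) *
    ∏ p : Fin n × Fin n with μ.rowLen p.2 < μ.rowLen p.1,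
      (x (w p.1) - tt n * x (w p.2)) / (x (w p.1) - x (w p.2))

/-- The same summand, in terms of the rearrangement `f` of `(μ₁, …, μₙ)`. -/
def termOf {n : ℕ} (f : Fin n → ℕ) : RatFun n :=
  (∏ i : Fin n, x i ^ f i) *
    ∏ p : Fin n × Fin n with f p.2 < f p.1, (x p.1 - tt n * x p.2) / (x p.1 - x p.2)

theorem term_eq_termOf (n : ℕ) (μ : YoungDiagram) (w : Equiv.Perm (Fin n)) :
    term n μ w = termOf fun i => μ.rowLen (w⁻¹ i) := by
  unfold term termOf
  congr 1
  · exact Fintype.prod_equiv w _ _ (by simp)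
  · simp only [Finset.prod_filter]
    exact Fintype.prod_equiv (w.prodCongr w) _ _ (by simp)

theorem term_eq_of_rel {n : ℕ} {μ : YoungDiagram} {v w : Equiv.Perm (Fin n)}
    (h : v⁻¹ * w ∈ stab n μ) : term n μ v = term n μ w := by
  rw [term_eq_termOf, term_eq_termOf]
  congr 1
  funext i
  have := h (w⁻¹ i)
  simpa using this

/-- The Hall--Littlewood polynomial `P_μ(x₁, …, xₙ; t)`, as a rational function. -/
def hallLittlewoodRat (n : ℕ) (μ : YoungDiagram) : RatFun n :=
  open Classical in
  if length μ ≤ n then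
    ∑ c : Equiv.Perm (Fin n) ⧸ stab n μ,
      Quotient.liftOn' c (term n μ)
        fun _ _ h => term_eq_of_rel (QuotientGroup.leftRel_apply.mp h)
  else 0

/-- The rearrangements of `(μ₁, …, μₙ)`. -/
def rearr (n : ℕ) (μ : YoungDiagram) : Finset (Fin n → ℕ) :=
  Finset.univ.image fun w : Equiv.Perm (Fin n) => fun i => μ.rowLen (w⁻¹ i)

theorem hallLittlewoodRat_eq (n : ℕ) (μ : YoungDiagram) (h : length μ ≤ n) :
    hallLittlewoodRat n μ = ∑ f ∈ rearr n μ, termOf f := by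
  classical
  rw [hallLittlewoodRat, if_pos h]
  have key : ∀ v w : Equiv.Perm (Fin n), v⁻¹ * w ∈ stab n μ ↔
      (fun i => μ.rowLen (v⁻¹ i : Fin n)) = fun i => μ.rowLen (w⁻¹ i : Fin n) := by
    intro v w
    constructor
    · intro h
      funext i
      simpa using h (w⁻¹ i)
    · intro h i
      simpa using congrFun h (w i)
  refine Finset.sum_nbij (fun c => Quotient.liftOn' c
    (fun (w : Equiv.Perm (Fin n)) (i : Fin n) => μ.rowLen (w⁻¹ i : Fin n))
    fun v w h => (key v w).1 (QuotientGroup.leftRel_apply.mp h)) ?_ ?_ ?_ ?_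
  · intro c _
    induction c using Quotient.inductionOn' with
    | h w => exact Finset.mem_image_of_mem _ (Finset.mem_univ w)
  · intro c _ d _ h
    induction c using Quotient.inductionOn' with
    | h v =>
      induction d using Quotient.inductionOn' with
      | h w =>
        exact Quotient.sound' (QuotientGroup.leftRel_apply.mpr ((key v w).2 h))
  · intro f hf
    obtain ⟨w, -, rfl⟩ := Finset.mem_image.1 (Finset.mem_coe.1 hf)
    exact ⟨Quotient.mk'' w, by simp, rfl⟩
  · intro c _
    induction c using Quotient.inductionOn' with
    | h w => exact term_eq_termOf n μ w

theorem sub_dvd_iff {n : ℕ} (i j : Fin n) (p : MvPolynomial (Fin n) (Polynomial ℤ)) :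
    (MvPolynomial.X i - MvPolynomial.X j) ∣ p ↔
      MvPolynomial.aeval (Function.update MvPolynomial.X i (MvPolynomial.X j) :
        Fin n → MvPolynomial (Fin n) (Polynomial ℤ)) p = 0 := by
  set σ := MvPolynomial.aeval (R := Polynomial ℤ) (Function.update MvPolynomial.X i (MvPolynomial.X j) :
        Fin n → MvPolynomial (Fin n) (Polynomial ℤ)) with hσ
  constructor
  · rintro ⟨q, rfl⟩
    by_cases h : j = i
    · subst h
      simp
    · simp [hσ, Function.update_of_ne h]
  · intro h
    set I := Ideal.span {(MvPolynomial.X i - MvPolynomial.X j :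
      MvPolynomial (Fin n) (Polynomial ℤ))}
    have key : (Ideal.Quotient.mkₐ (Polynomial ℤ) I).comp σ =
        Ideal.Quotient.mkₐ (Polynomial ℤ) I := by
      apply MvPolynomial.algHom_ext
      intro k
      by_cases hk : k = i
      · subst hk
        simp only [hσ, AlgHom.comp_apply, MvPolynomial.aeval_X, Function.update_self]
        rw [Ideal.Quotient.mkₐ_eq_mk, Ideal.Quotient.eq, Ideal.mem_span_singleton, dvd_sub_comm]
      · simp [hσ, Function.update_of_ne hk]
    have h2 := DFunLike.congr_fun key p
    rw [AlgHom.comp_apply, h, map_zero] at h2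
    rw [← Ideal.mem_span_singleton, ← Ideal.Quotient.eq_zero_iff_mem]
    exact h2.symm

theorem sub_ne_zero' {n : ℕ} {i j : Fin n} (h : i ≠ j) :
    (MvPolynomial.X i - MvPolynomial.X j : MvPolynomial (Fin n) (Polynomial ℤ)) ≠ 0 :=
  sub_ne_zero.2 fun h' => h (MvPolynomial.X_injective h')

theorem prime_sub {n : ℕ} {i j : Fin n} (h : i ≠ j) :
    Prime (MvPolynomial.X i - MvPolynomial.X j : MvPolynomial (Fin n) (Polynomial ℤ)) := by
  refine ⟨sub_ne_zero' h, ?_, ?_⟩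
  · intro hu
    have := (sub_dvd_iff i j 1).1 (hu.dvd)
    simp at this
  · intro a b hab
    rw [sub_dvd_iff] at hab ⊢
    rw [sub_dvd_iff]
    simpa using hab

/-- The Vandermonde product. -/
def vand (n : ℕ) : MvPolynomial (Fin n) (Polynomial ℤ) :=
  ∏ i : Fin n, ∏ j ∈ Finset.Ioi i, (MvPolynomial.X j - MvPolynomial.X i)

theorem vand_ne_zero (n : ℕ) : vand n ≠ 0 := by
  refine Finset.prod_ne_zero_iff.2 fun i _ => Finset.prod_ne_zero_iff.2 fun j hj => ?_
  exact sub_ne_zero' (Finset.mem_Ioi.1 hj).ne'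

theorem rename_vand {n : ℕ} (σ : Equiv.Perm (Fin n)) :
    MvPolynomial.rename σ (vand n) = (Equiv.Perm.sign σ : ℤ) • vand n := by
  have h : vand n = (Matrix.vandermonde (MvPolynomial.X :
      Fin n → MvPolynomial (Fin n) (Polynomial ℤ))).det := (Matrix.det_vandermonde _).symm
  have h2 : MvPolynomial.rename σ (vand n) = ((Matrix.vandermonde (MvPolynomial.X :
      Fin n → MvPolynomial (Fin n) (Polynomial ℤ))).submatrix σ id).det := by
    rw [h, AlgHom.map_det]
    congr 1
    ext i j : 2
    simp [Matrix.vandermonde_apply]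
  rw [h2, Matrix.det_permute, h]
  simp

theorem vand_dvd {n : ℕ} {p : MvPolynomial (Fin n) (Polynomial ℤ)}
    (hp : ∀ i j, i ≠ j → MvPolynomial.rename (Equiv.swap i j) p = -p) : vand n ∣ p := by
  have h1 : ∀ i j : Fin n, i ≠ j →
      (MvPolynomial.X i - MvPolynomial.X j : MvPolynomial (Fin n) (Polynomial ℤ)) ∣ p := by
    intro i j hij
    rw [sub_dvd_iff]
    set σ := MvPolynomial.aeval (R := Polynomial ℤ) (Function.update MvPolynomial.X i (MvPolynomial.X j) :
        Fin n → MvPolynomial (Fin n) (Polynomial ℤ)) with hσ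
    have key : σ.comp (MvPolynomial.rename (Equiv.swap i j)) = σ := by
      apply MvPolynomial.algHom_ext
      intro k
      by_cases hk : k = i
      · subst hk
        simp [hσ, Function.update_of_ne hij.symm]
      · by_cases hk' : k = j
        · subst hk'
          simp [hσ, Function.update_of_ne hij.symm]
        · simp [hσ, Equiv.swap_apply_of_ne_of_ne hk hk']
    have h2 := DFunLike.congr_fun key p
    rw [AlgHom.comp_apply, hp i j hij, map_neg] at h2
    exact self_eq_neg.1 h2.symm
  have h3 : vand n = ∏ q : Fin n × Fin n with q.1 < q.2,
      (MvPolynomial.X q.2 - MvPolynomial.X q.1) := by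
    rw [vand, Finset.prod_filter, Fintype.prod_prod_type]
    refine Finset.prod_congr rfl fun i _ => ?_
    rw [← Finset.prod_filter]
    congr 1
    ext j
    simp
  rw [h3]
  apply Finset.prod_dvd_of_isRelPrime
  · intro q hq r hr hqr
    have hq' : q.1 < q.2 := by simpa using hq
    have hr' : r.1 < r.2 := by simpa using hr
    refine (prime_sub hq'.ne').irreducible.isRelPrime_iff_not_dvd.2 ?_
    rw [sub_dvd_iff]
    intro h
    simp only [map_sub, MvPolynomial.aeval_X, sub_eq_zero, Function.update_apply] at h
    apply hqr
    split_ifs at h with h4 h5 h5 <;> have h6 := MvPolynomial.X_injective h <;>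
      ext <;> simp only [Fin.ext_iff, Fin.lt_def] at * <;> omega
  · intro q hq
    exact h1 _ _ (by simpa using (show q.1 < q.2 by simpa using hq).ne')

theorem exists_vand_mul_termOf {n : ℕ} (f : Fin n → ℕ) :
    ∃ N, algebraMap (MvPolynomial (Fin n) (Polynomial ℤ)) (RatFun n) N =
      algebraMap _ _ (vand n) * termOf f := by
  set D : MvPolynomial (Fin n) (Polynomial ℤ) :=
    ∏ p : Fin n × Fin n with f p.2 < f p.1, (MvPolynomial.X p.1 - MvPolynomial.X p.2) with hD
  have hne : ∀ p : Fin n × Fin n, f p.2 < f p.1 → p.1 ≠ p.2 := by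
    intro p h h'
    rw [h'] at h
    exact lt_irrefl _ h
  have hD0 : D ≠ 0 := Finset.prod_ne_zero_iff.2 fun p hp =>
    sub_ne_zero' (hne p (by simpa using hp))
  have hdvd : D ∣ vand n := by
    let g : Fin n → Fin n → MvPolynomial (Fin n) (Polynomial ℤ) := fun i j =>
      if f i < f j then MvPolynomial.X j - MvPolynomial.X i else 1
    have e : D = ∏ i, ∏ j ∈ Finset.Ioi i, g j i * g i j := by
      rw [Finset.prod_prod_Ioi_mul_eq_prod_prod_off_diag, hD, Finset.prod_filter,
        Fintype.prod_prod_type]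
      refine Finset.prod_congr rfl fun i _ => ?_
      rw [← Finset.mul_prod_erase Finset.univ _ (Finset.mem_univ i)]
      simp [g]
      rw [← Finset.compl_singleton]
    rw [e, vand]
    refine Finset.prod_dvd_prod_of_dvd _ _ fun i _ => Finset.prod_dvd_prod_of_dvd _ _ fun j _ => ?_
    simp only [g]
    split_ifs with h1 h2 h2
    · omega
    · rw [mul_one, dvd_sub_comm]
    · rw [one_mul]
    · simp
  obtain ⟨E, hE⟩ := hdvd
  refine ⟨E * ((∏ i, MvPolynomial.X i ^ f i) * ∏ p : Fin n × Fin n with f p.2 < f p.1,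
    (MvPolynomial.X p.1 - MvPolynomial.C Polynomial.X * MvPolynomial.X p.2)), ?_⟩
  have hD1 : algebraMap (MvPolynomial (Fin n) (Polynomial ℤ)) (RatFun n) D ≠ 0 := by
    simpa using hD0
  rw [termOf, Finset.prod_div_distrib]
  have e1 : (∏ p : Fin n × Fin n with f p.2 < f p.1, (x p.1 - x p.2)) =
      algebraMap (MvPolynomial (Fin n) (Polynomial ℤ)) (RatFun n) D := by
    simp [hD, map_prod, x]
  rw [e1, hE, map_mul, map_mul]
  field_simp
  simp only [map_mul, map_prod, map_sub, map_pow, x, tt]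
  ring

theorem rename_rearr {n : ℕ} (μ : YoungDiagram) (σ : Equiv.Perm (Fin n)) (f : Fin n → ℕ)
    (hf : f ∈ rearr n μ) : (fun i => f (σ⁻¹ i)) ∈ rearr n μ := by
  simp only [rearr, Finset.mem_image, Finset.mem_univ, true_and] at hf ⊢
  obtain ⟨w, rfl⟩ := hf
  exact ⟨σ * w, by simp⟩

/-- The rational function `P_μ(x₁, …, xₙ; t)` is a polynomial. -/
theorem exists_poly (n : ℕ) (μ : YoungDiagram) :
    ∃ p, algebraMap (MvPolynomial (Fin n) (Polynomial ℤ)) (RatFun n) p =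
      hallLittlewoodRat n μ := by
  by_cases h : length μ ≤ n
  swap
  · exact ⟨0, by simp [hallLittlewoodRat, h]⟩
  rw [hallLittlewoodRat_eq n μ h]
  set S := ∑ f ∈ rearr n μ, termOf f with hS
  choose N hN using fun f : Fin n → ℕ => exists_vand_mul_termOf f
  set M := ∑ f ∈ rearr n μ, N f with hM
  have hMS : algebraMap (MvPolynomial (Fin n) (Polynomial ℤ)) (RatFun n) M =
      algebraMap _ _ (vand n) * S := by
    rw [hM, map_sum, hS, Finset.mul_sum]
    exact Finset.sum_congr rfl fun f _ => hN f
  have hinj : Function.Injective (algebraMap (MvPolynomial (Fin n) (Polynomial ℤ)) (RatFun n)) :=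
    IsFractionRing.injective _ _
  have hdvd : vand n ∣ M := by
    apply vand_dvd
    intro i j hij
    set σ := Equiv.swap i j
    let ρ : RatFun n →+* RatFun n := (IsFractionRing.ringEquivOfRingEquiv
      (MvPolynomial.renameEquiv (Polynomial ℤ) σ).toRingEquiv : RatFun n ≃+* RatFun n)
    have hρ : ∀ p : MvPolynomial (Fin n) (Polynomial ℤ),
        ρ (algebraMap _ _ p) = algebraMap _ _ (MvPolynomial.rename σ p) := fun p =>
      IsFractionRing.ringEquivOfRingEquiv_algebraMap _ _
    have hx : ∀ k, ρ (x k) = x (σ k) := fun k => by rw [x, hρ, MvPolynomial.rename_X, x]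
    have ht : ρ (tt n) = tt n := by rw [tt, hρ, MvPolynomial.rename_C]
    have hterm : ∀ f : Fin n → ℕ, ρ (termOf f) = termOf fun k => f (σ⁻¹ k) := by
      intro f
      simp only [termOf, map_mul, map_prod, map_pow, map_div₀, map_sub, hx, ht]
      congr 1
      · exact Fintype.prod_equiv σ _ _ (by simp)
      · simp only [Finset.prod_filter]
        exact Fintype.prod_equiv (σ.prodCongr σ) _ _ (by simp)
    have hρS : ρ S = S := by
      rw [hS, map_sum]
      refine Finset.sum_nbij' (fun f k => f (σ⁻¹ k)) (fun f k => f (σ k)) ?_ ?_ ?_ ?_ ?_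
      · intro f hf
        exact rename_rearr μ σ f hf
      · intro f hf
        simpa using rename_rearr μ σ⁻¹ f hf
      · intro f _
        simp
      · intro f _
        simp
      · intro f _
        exact hterm f
    apply hinj
    rw [← hρ, hMS, map_mul, hρ, rename_vand, hρS, map_neg, hMS]
    simp [σ, Equiv.Perm.sign_swap hij]
  obtain ⟨p, hp⟩ := hdvd
  refine ⟨p, ?_⟩
  have h0 : algebraMap (MvPolynomial (Fin n) (Polynomial ℤ)) (RatFun n) (vand n) ≠ 0 := by
    simpa using vand_ne_zero n
  apply mul_left_cancel₀ h0
  rw [← hMS, hp, map_mul]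

/-- The Hall--Littlewood polynomial `P_μ(x₁, …, xₙ; t)` in `ℤ[t][x₁, …, xₙ]`; it is pinned down by
`algebraMap_hallLittlewoodPoly`. -/
def hallLittlewoodPoly (n : ℕ) (μ : YoungDiagram) : MvPolynomial (Fin n) (Polynomial ℤ) :=
  (exists_poly n μ).choose

theorem algebraMap_hallLittlewoodPoly (n : ℕ) (μ : YoungDiagram) :
    algebraMap _ (RatFun n) (hallLittlewoodPoly n μ) = hallLittlewoodRat n μ :=
  (exists_poly n μ).choose_spec

/-- Setting the last variable to zero. -/
def kill (n : ℕ) :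
    MvPolynomial (Fin (n + 1)) (Polynomial ℤ) →ₐ[Polynomial ℤ] MvPolynomial (Fin n) (Polynomial ℤ) :=
  MvPolynomial.killCompl (Fin.castSucc_injective n)

theorem kill_X {n : ℕ} (i : Fin n) : kill n (MvPolynomial.X i.castSucc) = MvPolynomial.X i := by
  rw [kill, ← MvPolynomial.rename_X (R := Polynomial ℤ) Fin.castSucc i,
    MvPolynomial.killCompl_rename_app]

theorem kill_X_last (n : ℕ) : kill n (MvPolynomial.X (Fin.last n)) = 0 := by
  simp [kill, MvPolynomial.killCompl]

/-- `Spec k l`: the rational function `k` specializes to `l` when the last variable is zero. -/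
def Spec {n : ℕ} (k : RatFun (n + 1)) (l : RatFun n) : Prop :=
  ∃ N D, kill n D ≠ 0 ∧ k = algebraMap _ _ N / algebraMap _ _ D ∧
    l = algebraMap _ _ (kill n N) / algebraMap _ _ (kill n D)

theorem alg_ne_zero {n : ℕ} {D : MvPolynomial (Fin n) (Polynomial ℤ)} (h : D ≠ 0) :
    algebraMap _ (RatFun n) D ≠ 0 := by simpa using h

theorem ne_zero_of_kill {n : ℕ} {D : MvPolynomial (Fin (n + 1)) (Polynomial ℤ)}
    (h : kill n D ≠ 0) : D ≠ 0 := by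
  rintro rfl
  exact h (map_zero _)

theorem Spec.of_div {n : ℕ} (N : MvPolynomial (Fin (n + 1)) (Polynomial ℤ))
    {D : MvPolynomial (Fin (n + 1)) (Polynomial ℤ)} (h : kill n D ≠ 0) :
    Spec (algebraMap _ (RatFun (n + 1)) N / algebraMap _ (RatFun (n + 1)) D)
      (algebraMap _ (RatFun n) (kill n N) / algebraMap _ (RatFun n) (kill n D)) :=
  ⟨N, D, h, rfl, rfl⟩

theorem Spec.of_poly {n : ℕ} (N : MvPolynomial (Fin (n + 1)) (Polynomial ℤ)) :
    Spec (algebraMap _ (RatFun (n + 1)) N) (algebraMap _ (RatFun n) (kill n N)) :=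
  ⟨N, 1, by simp, by simp, by simp⟩

theorem Spec.mul {n : ℕ} {k k' : RatFun (n + 1)} {l l' : RatFun n} (h : Spec k l)
    (h' : Spec k' l') : Spec (k * k') (l * l') := by
  obtain ⟨N, D, hD, rfl, rfl⟩ := h
  obtain ⟨N', D', hD', rfl, rfl⟩ := h'
  refine ⟨N * N', D * D', by rw [map_mul]; exact mul_ne_zero hD hD', ?_, ?_⟩ <;>
    simp only [map_mul, div_mul_div_comm]

theorem Spec.add {n : ℕ} {k k' : RatFun (n + 1)} {l l' : RatFun n} (h : Spec k l)
    (h' : Spec k' l') : Spec (k + k') (l + l') := by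
  obtain ⟨N, D, hD, rfl, rfl⟩ := h
  obtain ⟨N', D', hD', rfl, rfl⟩ := h'
  refine ⟨N * D' + D * N', D * D', by rw [map_mul]; exact mul_ne_zero hD hD', ?_, ?_⟩
  · rw [div_add_div _ _ (alg_ne_zero (ne_zero_of_kill hD)) (alg_ne_zero (ne_zero_of_kill hD'))]
    simp only [map_mul, map_add]
  · rw [div_add_div _ _ (alg_ne_zero hD) (alg_ne_zero hD')]
    simp only [map_mul, map_add]

theorem Spec.zero {n : ℕ} : Spec (0 : RatFun (n + 1)) 0 := by
  simpa using Spec.of_poly (0 : MvPolynomial (Fin (n + 1)) (Polynomial ℤ))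

theorem Spec.one {n : ℕ} : Spec (1 : RatFun (n + 1)) 1 := by
  simpa using Spec.of_poly (1 : MvPolynomial (Fin (n + 1)) (Polynomial ℤ))

theorem Spec.sum {n : ℕ} {ι : Type*} (s : Finset ι) {k : ι → RatFun (n + 1)} {l : ι → RatFun n}
    (h : ∀ i ∈ s, Spec (k i) (l i)) : Spec (∑ i ∈ s, k i) (∑ i ∈ s, l i) := by
  classical
  induction s using Finset.induction_on with
  | empty => simpa using Spec.zero
  | insert a s ha ih =>
    rw [Finset.sum_insert ha, Finset.sum_insert ha]
    exact (h a (Finset.mem_insert_self _ _)).add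
      (ih fun i hi => h i (Finset.mem_insert_of_mem hi))

theorem Spec.prod {n : ℕ} {ι : Type*} (s : Finset ι) {k : ι → RatFun (n + 1)} {l : ι → RatFun n}
    (h : ∀ i ∈ s, Spec (k i) (l i)) : Spec (∏ i ∈ s, k i) (∏ i ∈ s, l i) := by
  classical
  induction s using Finset.induction_on with
  | empty => simpa using Spec.one
  | insert a s ha ih =>
    rw [Finset.prod_insert ha, Finset.prod_insert ha]
    exact (h a (Finset.mem_insert_self _ _)).mul
      (ih fun i hi => h i (Finset.mem_insert_of_mem hi))

theorem Spec.pow {n : ℕ} {k : RatFun (n + 1)} {l : RatFun n} (h : Spec k l) (m : ℕ) :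
    Spec (k ^ m) (l ^ m) := by
  rw [← Fin.prod_const, ← Fin.prod_const]
  exact Spec.prod _ fun _ _ => h

theorem Spec.eq_of_poly {n : ℕ} {p : MvPolynomial (Fin (n + 1)) (Polynomial ℤ)} {l : RatFun n}
    (h : Spec (algebraMap _ _ p) l) : l = algebraMap _ _ (kill n p) := by
  obtain ⟨N, D, hD, h1, rfl⟩ := h
  rw [eq_div_iff (alg_ne_zero (ne_zero_of_kill hD)), ← map_mul] at h1
  have h2 := IsFractionRing.injective (MvPolynomial (Fin (n + 1)) (Polynomial ℤ)) _ h1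
  rw [div_eq_iff (alg_ne_zero hD), ← h2, map_mul, map_mul]

theorem Spec.termOf {n : ℕ} (f : Fin (n + 1) → ℕ) :
    Spec (termOf f) (if f (Fin.last n) = 0 then HallLittlewood.termOf fun i : Fin n => f i.castSucc
      else 0) := by
  let Y : Fin (n + 1) → MvPolynomial (Fin n) (Polynomial ℤ) := fun i => kill n (MvPolynomial.X i)
  have hY : Function.Injective Y := by
    intro i j
    induction i using Fin.lastCases with
    | last =>
      induction j using Fin.lastCases with
      | last => simp
      | cast j =>
        simp [Y, kill_X, kill_X_last, (MvPolynomial.X_ne_zero j).symm]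
    | cast i =>
      induction j using Fin.lastCases with
      | last => simp [Y, kill_X, kill_X_last]
      | cast j => simp [Y, kill_X]
  let y : Fin (n + 1) → RatFun n := fun i => algebraMap _ _ (Y i)
  have hcast : ∀ i : Fin n, y i.castSucc = x i := fun i => by simp [y, Y, kill_X, x]
  have hlast : y (Fin.last n) = 0 := by simp [y, Y, kill_X_last]
  have h1 : Spec (HallLittlewood.termOf f) ((∏ i, y i ^ f i) *
      ∏ p : Fin (n + 1) × Fin (n + 1) with f p.2 < f p.1,
        (y p.1 - tt n * y p.2) / (y p.1 - y p.2)) := by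
    refine (Spec.prod _ fun i _ => (Spec.of_poly _).pow _).mul (Spec.prod _ fun p hp => ?_)
    have hp' : p.1 ≠ p.2 := by
      intro h
      simp [h] at hp
    have hk : kill n (MvPolynomial.X p.1 - MvPolynomial.X p.2) ≠ 0 := by
      rw [map_sub, sub_ne_zero]
      exact fun h => hp' (hY h)
    have := Spec.of_div
      (MvPolynomial.X p.1 - MvPolynomial.C Polynomial.X * MvPolynomial.X p.2) hk
    have hC : kill n (MvPolynomial.C Polynomial.X) = MvPolynomial.C Polynomial.X :=
      MvPolynomial.killCompl_C _ _
    simp only [map_sub, map_mul, hC] at this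
    exact this
  convert h1 using 1
  split_ifs with h
  · rw [HallLittlewood.termOf, Fin.prod_univ_castSucc, hlast, h, pow_zero, mul_one]
    simp only [hcast]
    congr 1
    simp only [Finset.prod_filter, Fintype.prod_prod_type, Fin.prod_univ_castSucc, h, hcast, hlast]
    have h0 : ∀ i : Fin n, (x i : RatFun n) ≠ 0 := fun i => alg_ne_zero (MvPolynomial.X_ne_zero i)
    simp [h0]
  · rw [Fin.prod_univ_castSucc, hlast, zero_pow h, mul_zero, zero_mul]

theorem mem_rearr {n : ℕ} {μ : YoungDiagram} {f : Fin n → ℕ} : f ∈ rearr n μ ↔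
    Finset.univ.val.map f = Finset.univ.val.map fun i : Fin n => μ.rowLen i := by
  rw [Fin.univ_val_map, Fin.univ_val_map, Multiset.coe_eq_coe]
  simp only [rearr, Finset.mem_image, Finset.mem_univ, true_and]
  constructor
  · rintro ⟨w, rfl⟩
    exact w⁻¹.ofFn_comp_perm fun i : Fin n => μ.rowLen i
  · intro h
    set g : Fin n → ℕ := fun i => μ.rowLen i with hg
    have h1 : f ∘ Tuple.sort f = g ∘ Tuple.sort g := by
      apply List.ofFn_injective
      refine (((Tuple.sort f).ofFn_comp_perm f).trans
        (h.trans ((Tuple.sort g).ofFn_comp_perm g).symm)).eq_of_pairwise'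
        (Tuple.monotone_sort f).sortedLE_ofFn.pairwise
        (Tuple.monotone_sort g).sortedLE_ofFn.pairwise
    refine ⟨Tuple.sort f * (Tuple.sort g)⁻¹, ?_⟩
    funext i
    have := congrFun h1 ((Tuple.sort f)⁻¹ i)
    simpa [hg] using this.symm

theorem map_univ_succ {n : ℕ} (f : Fin (n + 1) → ℕ) :
    Finset.univ.val.map f = f (Fin.last n) ::ₘ Finset.univ.val.map fun i : Fin n => f i.castSucc := by
  rw [Fin.univ_castSuccEmb, Finset.cons_val, Multiset.map_cons, Finset.map_val, Multiset.map_map]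
  rfl

theorem rowLen_eq_zero_iff (μ : YoungDiagram) (i : ℕ) : μ.rowLen i = 0 ↔ length μ ≤ i := by
  rw [length, ← not_iff_not, not_le, ← YoungDiagram.mem_iff_lt_colLen,
    YoungDiagram.mem_iff_lt_rowLen, Nat.pos_iff_ne_zero]

/-- Stability: `P_μ(x₁, …, xₙ, 0; t) = P_μ(x₁, …, xₙ; t)`. -/
theorem kill_hallLittlewoodPoly (n : ℕ) (μ : YoungDiagram) :
    kill n (hallLittlewoodPoly (n + 1) μ) = hallLittlewoodPoly n μ := by
  apply IsFractionRing.injective (MvPolynomial (Fin n) (Polynomial ℤ)) (RatFun n)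
  rw [algebraMap_hallLittlewoodPoly]
  symm
  apply Spec.eq_of_poly
  rw [algebraMap_hallLittlewoodPoly]
  by_cases h : length μ ≤ n + 1
  swap
  · have h' : ¬ length μ ≤ n := by omega
    simpa [hallLittlewoodRat, h, h'] using Spec.zero
  rw [hallLittlewoodRat_eq _ _ h]
  have h1 := Spec.sum (rearr (n + 1) μ) fun f _ => Spec.termOf f
  convert h1 using 1
  rw [← Finset.sum_filter]
  by_cases h' : length μ ≤ n
  · rw [hallLittlewoodRat_eq _ _ h']
    have h0 : μ.rowLen n = 0 := (rowLen_eq_zero_iff μ n).2 h'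
    symm
    refine Finset.sum_nbij' (fun f i => f i.castSucc) (fun f => Fin.snoc f 0) ?_ ?_ ?_ ?_ ?_
    · intro f hf
      simp only [Finset.mem_filter, mem_rearr, map_univ_succ, Fin.val_last, Fin.val_castSucc] at hf
      rw [hf.2, h0, Multiset.cons_inj_right] at hf
      exact mem_rearr.2 hf.1
    · intro f hf
      rw [Finset.mem_filter, mem_rearr, map_univ_succ, map_univ_succ]
      simp only [Fin.snoc_last, Fin.snoc_castSucc, Fin.val_last, Fin.val_castSucc, h0, and_true]
      rw [Multiset.cons_inj_right]
      exact mem_rearr.1 hf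
    · intro f hf
      have := (Finset.mem_filter.1 hf).2
      funext i
      induction i using Fin.lastCases with
      | last => simp [this]
      | cast i => simp
    · intro f _
      simp
    · intro f _
      rfl
  · rw [hallLittlewoodRat, if_neg h', eq_comm]
    apply Finset.sum_eq_zero
    intro f hf
    exfalso
    obtain ⟨hf, h2⟩ := Finset.mem_filter.1 hf
    obtain ⟨w, -, rfl⟩ := Finset.mem_image.1 hf
    have := (rowLen_eq_zero_iff μ _).1 h2
    have h3 := (w⁻¹ (Fin.last n)).isLt
    omega

/-- The Hall--Littlewood symmetric function `P_μ(x₁, x₂, …; t)`, a formal power series over `ℤ[t]`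
in countably many variables: the coefficient of a monomial is its coefficient in
`P_μ(x₁, …, xₙ; t)` for any `n` such that the monomial only involves `x₁, …, xₙ`
(see `coeff_hallLittlewood`). -/
def hallLittlewood (μ : YoungDiagram) : MvPowerSeries ℕ (Polynomial ℤ) := fun d =>
  (hallLittlewoodPoly (d.support.sup id + 1) μ).coeff
    (d.comapDomain Fin.val Fin.val_injective.injOn)

theorem coeff_hallLittlewoodPoly_of_le {m n : ℕ} (h : m ≤ n) (μ : YoungDiagram) (d : ℕ →₀ ℕ)
    (hd : ∀ i ∈ d.support, i < m) :
    (hallLittlewoodPoly n μ).coeff (d.comapDomain Fin.val Fin.val_injective.injOn) =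
      (hallLittlewoodPoly m μ).coeff (d.comapDomain Fin.val Fin.val_injective.injOn) := by
  induction n, h using Nat.le_induction with
  | base => rfl
  | succ n h ih =>
    rw [← ih, ← kill_hallLittlewoodPoly n μ, kill, MvPolynomial.coeff_killCompl]
    refine congrArg (fun e => MvPolynomial.coeff e (hallLittlewoodPoly (n + 1) μ)) ?_
    ext i
    induction i using Fin.lastCases with
    | last =>
      rw [Finsupp.mapDomain_of_notMem_range _ _ (by simp)]
      simp only [Finsupp.comapDomain_apply, Fin.val_last]
      by_contra h'
      have := hd n (Finsupp.mem_support_iff.2 h')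
      omega
    | cast i =>
      rw [Finsupp.mapDomain_apply (Fin.castSucc_injective n)]
      simp

/-- Setting `x_i = 0` for `i > n` in `P_μ(x₁, x₂, …; t)` gives `P_μ(x₁, …, xₙ; t)`. -/
theorem coeff_hallLittlewood (n : ℕ) (μ : YoungDiagram) (d : Fin n →₀ ℕ) :
    MvPowerSeries.coeff (d.mapDomain Fin.val) (hallLittlewood μ) =
      (hallLittlewoodPoly n μ).coeff d := by
  set e := d.mapDomain Fin.val with he
  have h1 : e.comapDomain Fin.val Fin.val_injective.injOn = d :=
    Finsupp.comapDomain_mapDomain _ Fin.val_injective d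
  have h2 : ∀ i ∈ e.support, i < n := by
    intro i hi
    have := Finsupp.mapDomain_support hi
    obtain ⟨j, -, rfl⟩ := Finset.mem_image.1 this
    exact j.isLt
  have h3 : ∀ i ∈ e.support, i < e.support.sup id + 1 := fun i hi =>
    Nat.lt_succ_of_le (Finset.le_sup (f := id) hi)
  change (hallLittlewoodPoly (e.support.sup id + 1) μ).coeff _ = _
  rw [← coeff_hallLittlewoodPoly_of_le (le_max_left (e.support.sup id + 1) n) μ e h3,
    coeff_hallLittlewoodPoly_of_le (le_max_right (e.support.sup id + 1) n) μ e h2, h1]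

/-- `P_μ(x₁, …, xₙ; t)` as a power series over `R`, with the parameter `t` taken in `R`. -/
def PFin {R : Type*} [CommRing R] (t : R) (n : ℕ) (μ : YoungDiagram) : MvPowerSeries (Fin n) R :=
  (MvPolynomial.map (Polynomial.eval₂RingHom (Int.castRingHom R) t) (hallLittlewoodPoly n μ) :
    MvPolynomial (Fin n) R)

/-- `P_μ(x₁, x₂, …; t)` over `R`, with the parameter `t` taken in `R`. -/
def PInf {R : Type*} [CommRing R] (t : R) (μ : YoungDiagram) : MvPowerSeries ℕ R :=
  MvPowerSeries.map (Polynomial.eval₂RingHom (Int.castRingHom R) t) (hallLittlewood μ)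

/-- The factor `(1 + a x_i) / (1 - x_i²)`. -/
def singleFactor {σ R : Type*} [CommRing R] (a : R) (i : σ) : MvPowerSeries σ R :=
  (1 + MvPowerSeries.C a * MvPowerSeries.X i) *
    MvPowerSeries.invOfUnit (1 - MvPowerSeries.X i ^ 2) 1

/-- The factor `(1 - t x_i x_j) / (1 - x_i x_j)`. -/
def pairFactor {σ R : Type*} [CommRing R] (t : R) (i j : σ) : MvPowerSeries σ R :=
  (1 - MvPowerSeries.C t * MvPowerSeries.X i * MvPowerSeries.X j) *
    MvPowerSeries.invOfUnit (1 - MvPowerSeries.X i * MvPowerSeries.X j) 1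

end

end HallLittlewood

/-!
The sum over all partitions of `a ^ l(μ_o) P_μ` in `n` variables is a sum over all exponent vectors
`f : Fin n → ℕ` of `a ^ #{i | f i odd} x ^ f ∏ (x_i - t x_j) / (x_i - x_j)`, the product being over
the pairs with `f j < f i`, because the rearrangements of the various `μ` with at most `n` parts
exhaust these vectors (`sum_piAntidiag_eq_sum_parts`). To have convergent sums of rational
functions, `x_i` is replaced by `x_i u`, and the sum is a power series in `u` over the rational
functions.

Splitting according to the set `B` of indices with `f i ≠ 0`, and lowering these exponents by one,
gives a recursion over subsets of the index set (`genFun_eq_sum_powerset`). Lowering swaps odd and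
even exponents, so there is a weight `a` for odd and a weight `c` for even exponents, exchanged at
every step. The expected product satisfies the same recursion. This is the algebraic identity
`prod_mul_kernel_eq_sum`, whose two sides are polynomials in `a` that agree in top degree and, by
induction on the index set, at the points `a = -c y_m` with `y_m = x_m u`. As the recursion
determines its solution degree by degree in `u`, the two agree (`genFun_eq`).

After clearing the denominators of the product, the identity involves only polynomials over `ℤ[t]`,
and it specializes to any commutative ring (`grading_prod_factors`). The homogeneity of `P_μ` turns
it into a statement about each coefficient of a monomial in the `x_i` (`hasSum_PFin`). Infinitely
many variables reduce to finitely many, since setting the variables `x_i` with `i ≥ n` to zero is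
continuous and keeps the coefficients of the monomials in the first `n` variables.
-/

namespace HallLittlewood

/-! ### The identity behind the recursion -/

section Kernel

variable {ι A : Type*} [LinearOrder ι] [CommRing A]

/-- The product `∏ 1 / (1 - y_i²) ∏_{i < j} (1 - t y_i y_j) / (1 - y_i y_j)` over a set `S` of
indices, where `q i j` stands for the inverse of `1 - y_i y_j`. -/
def kernel (y : ι → A) (t : A) (q : ι → ι → A) (S : Finset ι) : A :=
  (∏ i ∈ S, q i i) * ∏ i ∈ S, ∏ j ∈ S with i < j, q i j * (1 - t * y i * y j)

theorem kernel_empty (y : ι → A) (t : A) (q : ι → ι → A) : kernel y t q ∅ = 1 := by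
  simp [kernel]

theorem kernel_insert {y : ι → A} {t : A} {q : ι → ι → A} (hq : ∀ i j, q i j = q j i) {m : ι}
    {S : Finset ι} (hm : m ∉ S) :
    kernel y t q (insert m S) =
      q m m * (∏ j ∈ S, q m j * (1 - t * y m * y j)) * kernel y t q S := by
  simp only [kernel, Finset.prod_filter]
  rw [Finset.prod_insert hm, Finset.prod_insert hm, Finset.prod_insert hm, if_neg (lt_irrefl m),
    one_mul]
  have h : (∏ j ∈ S, q m j * (1 - t * y m * y j)) =
      (∏ j ∈ S, if m < j then q m j * (1 - t * y m * y j) else 1) *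
        ∏ j ∈ S, if j < m then q j m * (1 - t * y j * y m) else 1 := by
    rw [← Finset.prod_mul_distrib]
    refine Finset.prod_congr rfl fun j hj => ?_
    rcases lt_trichotomy m j with h | h | h
    · simp [h, h.not_gt]
    · exact absurd (h ▸ hj) hm
    · rw [if_neg h.not_gt, if_pos h, one_mul, hq j m]
      ring
  have h2 : ∀ i ∈ S, (∏ j ∈ insert m S, if i < j then q i j * (1 - t * y i * y j) else 1) =
      (if i < m then q i m * (1 - t * y i * y m) else 1) *
        ∏ j ∈ S, if i < j then q i j * (1 - t * y i * y j) else 1 :=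
    fun i _ => Finset.prod_insert hm
  rw [Finset.prod_congr rfl h2, Finset.prod_mul_distrib, h]
  ring

/-- The recursion for the expected product, with weight `a` for odd and `c` for even exponents.
Both sides are polynomials in `a` of degree at most `#S` with the same coefficient of `a ^ #S`,
to which only `B = S` contributes. At `a = -c y_m` with `m ∈ S`, the sets `B` containing `m`
drop out, and the identity becomes the one for `S \ {m}` and `a = -c t y_m`. -/
theorem prod_mul_kernel_eq_sum [IsDomain A] {y : ι → A} (hy : Function.Injective y) {t : A}
    {q : ι → ι → A} (hq : ∀ i j, q i j * (1 - y i * y j) = 1) {θ : ι → ι → A}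
    (hθ : ∀ i j, i ≠ j → θ i j * (y i - y j) = y i - t * y j) (S : Finset ι) (c a : A) :
    (∏ i ∈ S, (c + a * y i)) * kernel y t q S =
      ∑ B ∈ S.powerset, c ^ (S \ B).card * (∏ b ∈ B, y b * (a + c * y b)) * kernel y t q B *
        ∏ b ∈ B, ∏ e ∈ S \ B, θ b e := by
  have hsymm : ∀ i j, q i j = q j i := by
    intro i j
    calc q i j = q i j * (q j i * (1 - y j * y i)) := by rw [hq, mul_one]
      _ = q i j * (1 - y i * y j) * q j i := by ring
      _ = q j i := by rw [hq, one_mul]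
  -- The points `-c y_m` used below are distinct only for `c ≠ 0`.
  by_cases hc : c = 0
  · subst hc
    rw [Finset.sum_eq_single S]
    · simp only [Finset.sdiff_self, Finset.card_empty, pow_zero, Finset.prod_empty,
        Finset.prod_const_one, zero_mul, zero_add, add_zero, one_mul, mul_one]
      congr 1
      exact Finset.prod_congr rfl fun i _ => mul_comm _ _
    · intro B hB hBS
      have : (S \ B).card ≠ 0 := by
        rw [Finset.card_ne_zero, Finset.sdiff_nonempty]
        exact fun h => hBS (Finset.Subset.antisymm (Finset.mem_powerset.1 hB) h)
      rw [zero_pow this]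
      ring
    · simp
  induction S using Finset.strongInduction generalizing a with
  | H S ih =>
  let p : Polynomial A := (∏ i ∈ S, (Polynomial.C c + Polynomial.X * Polynomial.C (y i))) *
    Polynomial.C (kernel y t q S)
  let r : Finset ι → Polynomial A := fun B =>
    Polynomial.C (c ^ (S \ B).card) *
      (∏ b ∈ B, Polynomial.C (y b) * (Polynomial.X + Polynomial.C (c * y b))) *
        Polynomial.C (kernel y t q B) * Polynomial.C (∏ b ∈ B, ∏ e ∈ S \ B, θ b e)
  have hp : ∀ z, p.eval z = (∏ i ∈ S, (c + z * y i)) * kernel y t q S := fun z => by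
    simp only [p, Polynomial.eval_mul, Polynomial.eval_C, Polynomial.eval_prod, Polynomial.eval_add,
      Polynomial.eval_X]
  have hr : ∀ B z, (r B).eval z = c ^ (S \ B).card * (∏ b ∈ B, y b * (z + c * y b)) *
      kernel y t q B * ∏ b ∈ B, ∏ e ∈ S \ B, θ b e := fun B z => by
    simp only [r, Polynomial.eval_mul, Polynomial.eval_C, Polynomial.eval_prod, Polynomial.eval_add,
      Polynomial.eval_X]
  suffices h : p - ∑ B ∈ S.powerset, r B = 0 by
    have h1 := congrArg (Polynomial.eval a) h
    rw [Polynomial.eval_sub, Polynomial.eval_finsetSum, hp, Polynomial.eval_zero, sub_eq_zero] at h1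
    rw [h1]
    exact Finset.sum_congr rfl fun B _ => hr B a
  have hl1 : ∀ i, (Polynomial.C c + Polynomial.X * Polynomial.C (y i)).natDegree ≤ 1 := fun i => by
    compute_degree
  have hl2 : ∀ i, (Polynomial.C (y i) * (Polynomial.X + Polynomial.C (c * y i))).natDegree ≤ 1 :=
    fun i => by compute_degree
  have hp_deg : p.natDegree ≤ S.card := by
    refine (Polynomial.natDegree_mul_C_le _ _).trans ?_
    refine (Polynomial.natDegree_prod_le _ _).trans ?_
    simpa using Finset.sum_le_sum fun i (_ : i ∈ S) => hl1 i
  have hr_deg : ∀ B, (r B).natDegree ≤ B.card := fun B => by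
    refine (Polynomial.natDegree_mul_C_le _ _).trans ?_
    refine (Polynomial.natDegree_mul_C_le _ _).trans ?_
    refine (Polynomial.natDegree_C_mul_le _ _).trans ?_
    refine (Polynomial.natDegree_prod_le _ _).trans ?_
    simpa using Finset.sum_le_sum fun i (_ : i ∈ B) => hl2 i
  have htop : p.coeff S.card = (r S).coeff S.card := by
    have e1 := Polynomial.coeff_prod_of_natDegree_le (s := S) _ 1 fun i _ => hl1 i
    have e2 := Polynomial.coeff_prod_of_natDegree_le (s := S) _ 1 fun i _ => hl2 i
    rw [mul_one] at e1 e2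
    simp only [p, r, Polynomial.coeff_mul_C, Polynomial.coeff_C_mul, e1, e2]
    simp
  refine Polynomial.eq_zero_of_degree_lt_of_eval_index_eq_zero (s := S)
    (v := fun m => -(c * y m)) ?_ ?_ ?_
  · intro i _ j _ h
    exact hy (mul_left_cancel₀ hc (neg_injective h))
  · rw [Polynomial.degree_lt_iff_coeff_zero]
    intro k hk
    rw [Polynomial.coeff_sub, Polynomial.finsetSum_coeff]
    rcases hk.eq_or_lt with rfl | hk
    · rw [Finset.sum_eq_single S, htop, sub_self]
      · intro B hB hBS
        refine Polynomial.coeff_eq_zero_of_natDegree_lt ((hr_deg B).trans_lt ?_)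
        exact Finset.card_lt_card (lt_of_le_of_ne (Finset.mem_powerset.1 hB) hBS)
      · simp
    · rw [Polynomial.coeff_eq_zero_of_natDegree_lt (hp_deg.trans_lt hk), Finset.sum_eq_zero, sub_zero]
      intro B hB
      refine Polynomial.coeff_eq_zero_of_natDegree_lt ((hr_deg B).trans_lt (lt_of_le_of_lt ?_ hk))
      exact Finset.card_le_card (Finset.mem_powerset.1 hB)
  · intro m hm
    obtain ⟨T, hmT, rfl⟩ : ∃ T, m ∉ T ∧ S = insert m T :=
      ⟨S.erase m, Finset.notMem_erase m S, (Finset.insert_erase hm).symm⟩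
    have hT := ih T (Finset.ssubset_insert hmT) (-(c * t * y m))
    rw [Polynomial.eval_sub, Polynomial.eval_finsetSum, hp, sub_eq_zero,
      Finset.sum_powerset_insert hmT]
    have hz : ∑ B ∈ T.powerset, (r (insert m B)).eval (-(c * y m)) = 0 := by
      refine Finset.sum_eq_zero fun B _ => ?_
      rw [hr, Finset.prod_eq_zero (Finset.mem_insert_self m B) (by ring)]
      ring
    rw [hz, add_zero, Finset.prod_insert hmT, kernel_insert hsymm hmT]
    have e1 : (∏ j ∈ T, (c + -(c * y m) * y j)) * ∏ j ∈ T, q m j * (1 - t * y m * y j) =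
        ∏ j ∈ T, (c + -(c * t * y m) * y j) := by
      rw [← Finset.prod_mul_distrib]
      refine Finset.prod_congr rfl fun j _ => ?_
      linear_combination c * (1 - t * y m * y j) * hq m j
    calc _ = c * (q m m * (1 - y m * y m)) * ((∏ j ∈ T, (c + -(c * y m) * y j)) *
          ∏ j ∈ T, q m j * (1 - t * y m * y j)) * kernel y t q T := by ring
      _ = c * ((∏ j ∈ T, (c + -(c * t * y m) * y j)) * kernel y t q T) := by
        rw [e1, hq]
        ring
      _ = _ := by
        rw [hT, Finset.mul_sum]
        refine Finset.sum_congr rfl fun B hB => ?_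
        have hmB : m ∉ B := fun h => hmT (Finset.mem_powerset.1 hB h)
        have e2 : insert m T \ B = insert m (T \ B) := Finset.insert_sdiff_of_notMem _ hmB
        have hm2 : m ∉ T \ B := fun h => hmT (Finset.mem_sdiff.1 h).1
        rw [hr, e2, Finset.card_insert_of_notMem hm2]
        simp only [Finset.prod_insert hm2]
        rw [Finset.prod_mul_distrib (s := B) (f := fun b => θ b m)]
        have e3 : (∏ b ∈ B, y b * (-(c * y m) + c * y b)) * ∏ b ∈ B, θ b m =
            ∏ b ∈ B, y b * (-(c * t * y m) + c * y b) := by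
          rw [← Finset.prod_mul_distrib]
          refine Finset.prod_congr rfl fun b hb => ?_
          linear_combination c * y b * hθ b m fun h => hmB (h ▸ hb)
        rw [← e3]
        ring

end Kernel

/-! ### Generating functions of exponent vectors -/

section GenFun

variable {ι K : Type*} [LinearOrder ι] [CommRing K]

/-- The contribution of an exponent vector `f` on the index set `S`: the monomial `x ^ f`, a factor
`a` for every odd and `c` for every even exponent, and `θ i j` for every pair with `f j < f i`. -/
def weight (x : ι → K) (θ : ι → ι → K) (c a : K) (S : Finset ι) (f : ι → ℕ) : K :=
  (∏ i ∈ S, if Odd (f i) then a else c) * (∏ i ∈ S, x i ^ f i) *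
    ∏ i ∈ S, ∏ j ∈ S with f j < f i, θ i j

/-- The generating function, by total degree, of the weights of all exponent vectors on `S`. -/
def genFun (x : ι → K) (θ : ι → ι → K) (c a : K) (S : Finset ι) : PowerSeries K :=
  PowerSeries.mk fun d => ∑ f ∈ S.piAntidiag d, weight x θ c a S f

theorem genFun_empty (x : ι → K) (θ : ι → ι → K) (c a : K) : genFun x θ c a ∅ = 1 := by
  ext d
  rw [genFun, PowerSeries.coeff_mk, PowerSeries.coeff_one]
  rcases eq_or_ne d 0 with rfl | hd
  · simp [weight]
  · simp [Finset.piAntidiag_empty_of_ne_zero hd, hd]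

/-- The exponent vector that vanishes off `B` and is `g + 1` on `B`: lowering its exponents on `B`
by one swaps the roles of `a` and `c` there. -/
theorem weight_add_one (x : ι → K) (θ : ι → ι → K) (c a : K) {S B : Finset ι}
    (hBS : B ⊆ S) (g : ι → ℕ) :
    weight x θ c a S (fun i => if i ∈ B then g i + 1 else 0) =
      c ^ (S \ B).card * (∏ b ∈ B, x b) * (∏ b ∈ B, ∏ e ∈ S \ B, θ b e) * weight x θ a c B g := by
  have key : ∀ φ : ι → K, ∏ i ∈ S, φ i = (∏ i ∈ S \ B, φ i) * ∏ i ∈ B, φ i := fun φ =>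
    (Finset.prod_sdiff hBS).symm
  set f : ι → ℕ := fun i => if i ∈ B then g i + 1 else 0 with hf
  have f1 : ∀ i ∈ B, f i = g i + 1 := fun i hi => if_pos hi
  have f0 : ∀ i ∈ S \ B, f i = 0 := fun i hi => if_neg (Finset.mem_sdiff.1 hi).2
  have h1 : (∏ i ∈ S, if Odd (f i) then a else c) =
      c ^ (S \ B).card * ∏ i ∈ B, if Odd (g i) then c else a := by
    rw [key]
    congr 1
    · rw [← Finset.prod_const]
      exact Finset.prod_congr rfl fun i hi => by simp [f0 i hi]
    · refine Finset.prod_congr rfl fun i hi => ?_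
      rw [f1 i hi]
      by_cases h : Odd (g i)
      · simp [h, Nat.odd_add_one]
      · simp [h, Nat.odd_add_one]
  have h2 : ∏ i ∈ S, x i ^ f i = (∏ b ∈ B, x b) * ∏ i ∈ B, x i ^ g i := by
    rw [key, Finset.prod_eq_one fun i hi => by rw [f0 i hi, pow_zero], one_mul,
      ← Finset.prod_mul_distrib]
    exact Finset.prod_congr rfl fun i hi => by rw [f1 i hi, pow_succ']
  have h3 : (∏ i ∈ S, ∏ j ∈ S with f j < f i, θ i j) =
      (∏ b ∈ B, ∏ e ∈ S \ B, θ b e) * ∏ i ∈ B, ∏ j ∈ B with g j < g i, θ i j := by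
    simp only [Finset.prod_filter]
    rw [key, Finset.prod_eq_one, one_mul, ← Finset.prod_mul_distrib]
    · refine Finset.prod_congr rfl fun i hi => ?_
      rw [key]
      congr 1
      · exact Finset.prod_congr rfl fun j hj => by rw [f0 j hj, f1 i hi, if_pos (Nat.succ_pos _)]
      · exact Finset.prod_congr rfl fun j hj => by simp only [f1 j hj, f1 i hi, add_lt_add_iff_right]
    · intro i hi
      exact Finset.prod_eq_one fun j _ => by rw [f0 i hi, if_neg (Nat.not_lt_zero _)]
  rw [weight, weight, h1, h2, h3]
  ring

theorem genFun_eq_sum_powerset (x : ι → K) (θ : ι → ι → K) (c a : K) (S : Finset ι) :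
    genFun x θ c a S = ∑ B ∈ S.powerset,
      PowerSeries.C (c ^ (S \ B).card * (∏ b ∈ B, x b) * ∏ b ∈ B, ∏ e ∈ S \ B, θ b e) *
        (PowerSeries.X ^ B.card * genFun x θ a c B) := by
  ext d
  have hmaps : ∀ f ∈ S.piAntidiag d, (S.filter fun i => f i ≠ 0) ∈ S.powerset :=
    fun f _ => Finset.mem_powerset.2 (Finset.filter_subset _ _)
  rw [map_sum, genFun, PowerSeries.coeff_mk,
    ← Finset.sum_fiberwise_of_maps_to hmaps (weight x θ c a S)]
  refine Finset.sum_congr rfl fun B hB => ?_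
  have hBS := Finset.mem_powerset.1 hB
  generalize hk : c ^ (S \ B).card * (∏ b ∈ B, x b) * (∏ b ∈ B, ∏ e ∈ S \ B, θ b e) = k
  rw [PowerSeries.coeff_C_mul, PowerSeries.coeff_X_pow_mul']
  have hmem : ∀ f ∈ (S.piAntidiag d).filter (fun f => (S.filter fun i => f i ≠ 0) = B),
      (∀ i, f i ≠ 0 ↔ i ∈ B) ∧ ∑ i ∈ B, f i = d := by
    intro f hf
    obtain ⟨hfS, hfB⟩ := Finset.mem_filter.1 hf
    obtain ⟨hsum, hsupp⟩ := Finset.mem_piAntidiag.1 hfS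
    rw [← hfB]
    refine ⟨fun i => ?_, ?_⟩
    · simpa using hsupp i
    · rw [← hsum, Finset.sum_filter_ne_zero]
  split_ifs with hd
  · rw [genFun, PowerSeries.coeff_mk, Finset.mul_sum]
    symm
    refine Finset.sum_nbij' (fun g i => if i ∈ B then g i + 1 else 0) (fun f i => f i - 1)
      ?_ ?_ ?_ ?_ ?_
    · intro g hg
      obtain ⟨hg, hg'⟩ := Finset.mem_piAntidiag.1 hg
      rw [Finset.mem_filter, Finset.mem_piAntidiag]
      refine ⟨⟨?_, fun i hi => ?_⟩, ?_⟩
      · rw [Finset.sum_ite_mem, Finset.inter_eq_right.2 hBS, Finset.sum_add_distrib, hg]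
        simp [hd]
      · by_contra h
        exact hi (if_neg fun h' => h (hBS h'))
      · ext i
        by_cases hi : i ∈ B
        · simp [hi, hBS hi]
        · simp [hi]
    · intro f hf
      obtain ⟨h1, h2⟩ := hmem f hf
      rw [Finset.mem_piAntidiag]
      refine ⟨?_, fun i hi => (h1 i).1 fun h => hi (by simp [h])⟩
      have : ∑ i ∈ B, (f i - 1) + B.card = d := by
        rw [← h2, Finset.card_eq_sum_ones, ← Finset.sum_add_distrib]
        refine Finset.sum_congr rfl fun i hi => ?_
        have := (h1 i).2 hi
        omega
      omega
    · intro g hg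
      obtain ⟨hg, hg'⟩ := Finset.mem_piAntidiag.1 hg
      funext i
      by_cases hi : i ∈ B
      · simp [hi]
      · have : g i = 0 := by
          by_contra h
          exact hi (hg' i h)
        simp [hi, this]
    · intro f hf
      obtain ⟨h1, h2⟩ := hmem f hf
      funext i
      by_cases hi : i ∈ B
      · have := (h1 i).2 hi
        simp only [hi, if_true]
        omega
      · have : f i = 0 := by
          by_contra h
          exact hi ((h1 i).1 h)
        simp [hi, this]
    · intro g hg
      rw [← hk]
      exact (weight_add_one x θ c a hBS g).symm
  · rw [mul_zero]
    refine Finset.sum_eq_zero fun f hf => ?_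
    obtain ⟨h1, h2⟩ := hmem f hf
    exfalso
    apply hd
    rw [← h2, Finset.card_eq_sum_ones]
    exact Finset.sum_le_sum fun i hi => Nat.one_le_iff_ne_zero.2 ((h1 i).2 hi)

/-- The closed form satisfies the recursion `genFun_eq_sum_powerset`, so the difference of the two
sides is divisible by every power of the degree variable. -/
theorem genFun_eq [IsDomain K] {x : ι → K} (hx : Function.Injective x) {t : K} {θ : ι → ι → K}
    (hθ : ∀ i j, i ≠ j → θ i j * (x i - x j) = x i - t * x j) {q : ι → ι → PowerSeries K}
    (hq : ∀ i j, q i j * (1 - PowerSeries.C (x i) * PowerSeries.X *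
      (PowerSeries.C (x j) * PowerSeries.X)) = 1) (c a : K) (S : Finset ι) :
    genFun x θ c a S =
      (∏ i ∈ S, (PowerSeries.C c + PowerSeries.C a * (PowerSeries.C (x i) * PowerSeries.X))) *
        kernel (fun i => PowerSeries.C (x i) * PowerSeries.X) (PowerSeries.C t) q S := by
  set y : ι → PowerSeries K := fun i => PowerSeries.C (x i) * PowerSeries.X with hy
  have hyinj : Function.Injective y := fun i j h =>
    hx (PowerSeries.C_injective (mul_right_cancel₀ PowerSeries.X_ne_zero h))
  have hθ' : ∀ i j, i ≠ j → PowerSeries.C (θ i j) * (y i - y j) = y i - PowerSeries.C t * y j := by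
    intro i j hij
    have := congrArg (PowerSeries.C (R := K)) (hθ i j hij)
    simp only [map_mul, map_sub] at this
    linear_combination PowerSeries.X * this
  let H : K → K → Finset ι → PowerSeries K := fun c a S =>
    (∏ i ∈ S, (PowerSeries.C c + PowerSeries.C a * y i)) * kernel y (PowerSeries.C t) q S
  have hH : ∀ c a S, H c a S = ∑ B ∈ S.powerset,
      PowerSeries.C (c ^ (S \ B).card * (∏ b ∈ B, x b) * ∏ b ∈ B, ∏ e ∈ S \ B, θ b e) *
        (PowerSeries.X ^ B.card * H a c B) := by
    intro c a S
    refine (prod_mul_kernel_eq_sum hyinj hq hθ' S _ _).trans (Finset.sum_congr rfl fun B _ => ?_)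
    simp only [H, hy, map_mul, map_pow, map_prod, Finset.prod_mul_distrib, Finset.prod_const]
    ring
  have hdvd : ∀ (d : ℕ) (c a : K) (S : Finset ι),
      PowerSeries.X ^ d ∣ genFun x θ c a S - H c a S := by
    intro d
    induction d with
    | zero => exact fun c a S => by simp
    | succ d ih =>
      intro c a S
      rw [genFun_eq_sum_powerset, hH, ← Finset.sum_sub_distrib]
      refine Finset.dvd_sum fun B _ => ?_
      rw [← mul_sub, ← mul_sub]
      apply Dvd.dvd.mul_left
      -- A nonempty `B` contributes a further factor `X`, and `B = ∅` contributes `1` to both sides.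
      rcases B.eq_empty_or_nonempty with rfl | hB
      · have : H a c ∅ = 1 := by simp [H, kernel_empty]
        simp [genFun_empty, this]
      · rw [pow_succ']
        exact mul_dvd_mul (dvd_pow_self _ hB.card_ne_zero) (ih a c B)
  rw [← sub_eq_zero]
  ext d
  exact PowerSeries.X_pow_dvd_iff.1 (hdvd (d + 1) c a S) d (Nat.lt_succ_self d)

end GenFun

/-! ### Grading of power series by degree -/

section Grading

variable {σ R : Type*} [CommRing R]

theorem hasSubst_X_smul_X [Finite σ] : MvPowerSeries.HasSubst fun s : σ =>
    (PowerSeries.C (MvPolynomial.X s : MvPolynomial σ R) * PowerSeries.X :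
      MvPowerSeries Unit (MvPolynomial σ R)) :=
  MvPowerSeries.hasSubst_of_constantCoeff_zero fun s => by
    rw [map_mul]
    exact mul_eq_zero_of_right _ (MvPowerSeries.constantCoeff_X ())

/-- The substitution `x_s ↦ x_s u`, which turns a power series in finitely many variables into the
power series in `u` whose coefficients are its homogeneous components. -/
noncomputable def grading (σ R : Type*) [CommRing R] [Finite σ] :
    MvPowerSeries σ R →ₐ[R] PowerSeries (MvPolynomial σ R) :=
  MvPowerSeries.substAlgHom hasSubst_X_smul_X

theorem grading_X [Finite σ] (s : σ) : grading σ R (MvPowerSeries.X s) =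
    PowerSeries.C (MvPolynomial.X s) * PowerSeries.X :=
  MvPowerSeries.substAlgHom_X hasSubst_X_smul_X s

theorem grading_C [Finite σ] (r : R) : grading σ R (MvPowerSeries.C r) =
    PowerSeries.C (MvPolynomial.C r) := by
  rw [MvPowerSeries.c_eq_algebraMap, AlgHom.commutes,
    IsScalarTower.algebraMap_apply R (MvPolynomial σ R) (PowerSeries (MvPolynomial σ R))]
  rfl

theorem coeff_coeff_grading [Finite σ] (F : MvPowerSeries σ R) (k : ℕ) (e : σ →₀ ℕ) :
    (PowerSeries.coeff k (grading σ R F)).coeff e =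
      if e.degree = k then MvPowerSeries.coeff e F else 0 := by
  classical
  have hmon : ∀ d : σ →₀ ℕ, (d.prod fun s m =>
      (PowerSeries.C (MvPolynomial.X s : MvPolynomial σ R) * PowerSeries.X : PowerSeries _) ^ m) =
      PowerSeries.C (MvPolynomial.monomial d 1) * PowerSeries.X ^ d.degree := by
    intro d
    simp only [Finsupp.prod, mul_pow, Finset.prod_mul_distrib]
    rw [Finset.prod_pow_eq_pow_sum, MvPolynomial.monomial_eq, Finsupp.degree_apply]
    simp only [Finsupp.prod, map_one, one_mul, map_prod, map_pow]
  have h := MvPowerSeries.coeff_subst (hasSubst_X_smul_X (σ := σ) (R := R)) F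
    (Finsupp.single () k)
  have hfin := MvPowerSeries.coeff_subst_finite (hasSubst_X_smul_X (σ := σ) (R := R)) F
    (Finsupp.single () k)
  have h2 : ∀ d : σ →₀ ℕ, MvPowerSeries.coeff (Finsupp.single () k) (d.prod fun s m =>
      (PowerSeries.C (MvPolynomial.X s : MvPolynomial σ R) * PowerSeries.X : PowerSeries _) ^ m) =
      if d.degree = k then MvPolynomial.monomial d 1 else 0 := by
    intro d
    rw [hmon]
    change PowerSeries.coeff k _ = _
    rw [PowerSeries.coeff_C_mul, PowerSeries.coeff_X_pow]
    simp [eq_comm]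
  simp only [h2] at h hfin
  have h3 : PowerSeries.coeff k (grading σ R F) = ∑ᶠ d : σ →₀ ℕ, MvPowerSeries.coeff d F •
      if d.degree = k then MvPolynomial.monomial d (1 : R) else 0 := by
    rw [← h, grading, MvPowerSeries.coe_substAlgHom]
    rfl
  rw [h3]
  have h4 := (MvPolynomial.lcoeff R e).toAddMonoidHom.map_finsum hfin
  simp only [LinearMap.toAddMonoidHom_coe, MvPolynomial.lcoeff_apply] at h4
  rw [h4, finsum_eq_single _ e]
  · split_ifs <;> simp
  · intro d hd
    split_ifs <;> simp [MvPolynomial.coeff_monomial, hd]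

theorem grading_coe_of_isHomogeneous [Finite σ] {p : MvPolynomial σ R} {m : ℕ}
    (hp : p.IsHomogeneous m) :
    grading σ R p = PowerSeries.C p * PowerSeries.X ^ m := by
  ext k e
  rw [coeff_coeff_grading, PowerSeries.coeff_C_mul, PowerSeries.coeff_X_pow, MvPolynomial.coeff_coe]
  by_cases hc : p.coeff e = 0
  · rw [hc]
    split_ifs <;> simp [hc]
  · have : e.degree = m := by
      rw [Finsupp.degree_eq_weight_one]
      exact hp hc
    subst this
    by_cases h : k = e.degree
    · simp [h]
    · simp [h, Ne.symm h]

theorem isHomogeneous_of_mul [Finite σ] [IsDomain R] {v p : MvPolynomial σ R} {m d : ℕ} (hv0 : v ≠ 0)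
    (hv : v.IsHomogeneous m) (hvp : (v * p).IsHomogeneous (m + d)) : p.IsHomogeneous d := by
  have h := grading_coe_of_isHomogeneous hvp
  rw [MvPolynomial.coe_mul, map_mul, grading_coe_of_isHomogeneous hv, map_mul, pow_add] at h
  have h1 : grading σ R p = PowerSeries.C p * PowerSeries.X ^ d := by
    have h0 : PowerSeries.C v * PowerSeries.X ^ m ≠ 0 :=
      mul_ne_zero ((map_ne_zero_iff _ PowerSeries.C_injective).2 hv0) (pow_ne_zero _ PowerSeries.X_ne_zero)
    refine mul_left_cancel₀ h0 (h.trans ?_)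
    ring
  intro e he
  have h2 := coeff_coeff_grading (p : MvPowerSeries σ R) e.degree e
  rw [h1, PowerSeries.coeff_C_mul, PowerSeries.coeff_X_pow, if_pos rfl, MvPolynomial.coeff_coe] at h2
  by_contra hne
  rw [if_neg, mul_zero, MvPolynomial.coeff_zero] at h2
  · exact he h2.symm
  · intro h3
    exact hne (by rw [← h3, Finsupp.degree_eq_weight_one]; rfl)

end Grading

/-! ### Exponent vectors and partitions -/

section Rearrangements

variable {n : ℕ}

/-- The partition obtained by sorting the entries of `f`. -/
def toYoung (f : Fin n → ℕ) : YoungDiagram :=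
  YoungDiagram.ofRowLens ((Finset.univ.val.map f).sort (· ≥ ·))
    (Multiset.pairwise_sort _ _).sortedGE

-- Zero entries of the sorted list give empty rows, so that all `n` entries are row lengths.
theorem rowLen_toYoung (f : Fin n → ℕ) (i : Fin n) :
    (toYoung f).rowLen i = ((Finset.univ.val.map f).sort (· ≥ ·))[i]'(by simp) :=
  YoungDiagram.rowLen_ofRowLens (hw := (Multiset.pairwise_sort _ _).sortedGE)
    ⟨i, by simp⟩

theorem length_toYoung_le (f : Fin n → ℕ) : length (toYoung f) ≤ n := by
  by_contra! h
  rw [length, ← YoungDiagram.mem_iff_lt_colLen, toYoung, YoungDiagram.mem_ofRowLens] at h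
  obtain ⟨h, -⟩ := h
  simp at h

theorem mem_rearr_toYoung (f : Fin n → ℕ) : f ∈ rearr n (toYoung f) := by
  have key : ∀ (w : List ℕ) (hw : w.length = n),
      (Finset.univ.val.map fun i : Fin n => w[(i : ℕ)]'(hw ▸ i.isLt)) = (w : Multiset ℕ) := by
    rintro w rfl
    rw [Fin.univ_val_map, Multiset.coe_eq_coe]
    exact List.Perm.of_eq (List.ext_getElem (by simp) fun i _ _ => by simp)
  rw [mem_rearr]
  simp only [rowLen_toYoung]
  exact (Multiset.sort_eq _ (· ≥ ·)).symm.trans (key _ (by simp)).symm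

theorem eq_toYoung_of_mem_rearr {μ : YoungDiagram} {f : Fin n → ℕ} (hμ : length μ ≤ n)
    (hf : f ∈ rearr n μ) : toYoung f = μ := by
  have h1 := mem_rearr.1 (mem_rearr_toYoung f)
  rw [mem_rearr.1 hf, Fin.univ_val_map, Fin.univ_val_map, Multiset.coe_eq_coe] at h1
  have anti : ∀ ν : YoungDiagram, Antitone fun i : Fin n => ν.rowLen i := fun ν i j h =>
    ν.rowLen_anti i j h
  have h2 := List.ofFn_injective (h1.eq_of_pairwise' (r := (· ≥ ·))
    (anti μ).sortedGE_ofFn.pairwise (anti (toYoung f)).sortedGE_ofFn.pairwise)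
  ext ⟨i, j⟩
  rw [YoungDiagram.mem_cells, YoungDiagram.mem_cells, YoungDiagram.mem_iff_lt_rowLen,
    YoungDiagram.mem_iff_lt_rowLen]
  by_cases hi : i < n
  · rw [show μ.rowLen i = (toYoung f).rowLen i from congrFun h2 ⟨i, hi⟩]
  · rw [(rowLen_eq_zero_iff μ i).2 (by omega),
      (rowLen_eq_zero_iff (toYoung f) i).2 ((length_toYoung_le f).trans (by omega))]

theorem mem_rearr_iff_toYoung_eq {μ : YoungDiagram} {f : Fin n → ℕ} (hμ : length μ ≤ n) :
    f ∈ rearr n μ ↔ toYoung f = μ :=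
  ⟨eq_toYoung_of_mem_rearr hμ, fun h => h ▸ mem_rearr_toYoung f⟩

theorem sum_eq_of_mem_rearr {μ : YoungDiagram} {f : Fin n → ℕ} (hf : f ∈ rearr n μ) :
    ∑ i, f i = ∑ i : Fin n, μ.rowLen i :=
  congrArg Multiset.sum (mem_rearr.1 hf)

theorem length_oddParts (μ : YoungDiagram) :
    length (oddParts μ) = μ.rowLens.countP fun r => Odd r := by
  rw [length, ← YoungDiagram.length_rowLens, oddParts, YoungDiagram.rowLens_length_ofRowLens,
    List.countP_eq_length_filter]
  intro r hr
  exact μ.pos_of_mem_rowLens r (List.mem_of_mem_filter hr)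

theorem length_oddParts_of_mem_rearr {μ : YoungDiagram} {f : Fin n → ℕ} (hμ : length μ ≤ n)
    (hf : f ∈ rearr n μ) :
    length (oddParts μ) = (Finset.univ.filter fun i => Odd (f i)).card := by
  have h1 : (Finset.univ.filter fun i => Odd (f i)).card =
      (Finset.univ.val.map f).countP fun r => Odd r := by
    rw [Multiset.countP_map]
    rfl
  have h2 : (Finset.univ.val.map fun i : Fin n => μ.rowLen i) =
      (((List.range n).map μ.rowLen : List ℕ) : Multiset ℕ) := by
    rw [Fin.univ_val_map, Multiset.coe_eq_coe]
    exact List.Perm.of_eq (List.ext_getElem (by simp) fun i h1 h2 => by simp)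
  rw [h1, mem_rearr.1 hf, h2, Multiset.coe_countP, length_oddParts, YoungDiagram.rowLens]
  obtain ⟨k, rfl⟩ := Nat.exists_eq_add_of_le hμ
  rw [List.range_add, List.map_append, List.countP_append, length]
  symm
  rw [Nat.add_eq_left, List.countP_eq_zero]
  intro r hr
  simp only [List.map_map, List.mem_map, Function.comp_apply] at hr
  obtain ⟨j, -, rfl⟩ := hr
  have h0 : μ.rowLen (μ.colLen 0 + j) = 0 :=
    (rowLen_eq_zero_iff μ _).2 (Nat.le_add_right _ _)
  simp [h0]

end Rearrangements

/-! ### Homogeneity of Hall--Littlewood polynomials -/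

section Homogeneous

open MvPolynomial

variable {n : ℕ}

theorem x_injective : Function.Injective (x : Fin n → RatFun n) := fun _ _ h =>
  X_injective (IsFractionRing.injective (MvPolynomial (Fin n) (Polynomial ℤ)) (RatFun n) h)

/-- Clearing denominators in a Hall--Littlewood polynomial by the product of all `x_i - x_j`. -/
theorem prod_sub_mul_hallLittlewoodPoly {μ : YoungDiagram} (hμ : length μ ≤ n) :
    (∏ p : Fin n × Fin n with p.1 ≠ p.2, (X p.1 - X p.2)) * hallLittlewoodPoly n μ =
      ∑ f ∈ rearr n μ, (∏ i, X i ^ f i) * ∏ p : Fin n × Fin n with p.1 ≠ p.2,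
        if f p.2 < f p.1 then X p.1 - C Polynomial.X * X p.2 else X p.1 - X p.2 := by
  apply IsFractionRing.injective (MvPolynomial (Fin n) (Polynomial ℤ)) (RatFun n)
  rw [map_mul, algebraMap_hallLittlewoodPoly, hallLittlewoodRat_eq n μ hμ, map_sum, Finset.mul_sum]
  refine Finset.sum_congr rfl fun f _ => ?_
  have h1 : (∏ p : Fin n × Fin n with f p.2 < f p.1, (x p.1 - tt n * x p.2) / (x p.1 - x p.2)) =
      ∏ p : Fin n × Fin n with p.1 ≠ p.2,
        if f p.2 < f p.1 then (x p.1 - tt n * x p.2) / (x p.1 - x p.2) else 1 := by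
    rw [← Finset.prod_filter, Finset.filter_filter]
    refine Finset.prod_congr (Finset.filter_congr fun p _ => ?_) fun _ _ => rfl
    exact ⟨fun h => ⟨fun h' => by simp [h'] at h, h⟩, fun h => h.2⟩
  rw [termOf, h1, map_mul, map_prod, map_prod, map_prod, mul_left_comm, ← Finset.prod_mul_distrib]
  congr 1
  · simp [x]
  · refine Finset.prod_congr rfl fun p hp => ?_
    have hp' : x p.1 - x p.2 ≠ (0 : RatFun n) :=
      sub_ne_zero.2 fun h => (Finset.mem_filter.1 hp).2 (x_injective h)
    have e : algebraMap (MvPolynomial (Fin n) (Polynomial ℤ)) (RatFun n) (X p.1 - X p.2) =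
        x p.1 - x p.2 := map_sub _ _ _
    rw [e]
    split_ifs
    · rw [mul_div_cancel₀ _ hp', map_sub, map_mul]
      rfl
    · rw [mul_one, e]

theorem hallLittlewoodPoly_eq_zero {μ : YoungDiagram} (hμ : ¬ length μ ≤ n) :
    hallLittlewoodPoly n μ = 0 := by
  apply IsFractionRing.injective (MvPolynomial (Fin n) (Polynomial ℤ)) (RatFun n)
  rw [algebraMap_hallLittlewoodPoly, hallLittlewoodRat, if_neg hμ, map_zero]

theorem isHomogeneous_hallLittlewoodPoly (n : ℕ) (μ : YoungDiagram) :
    (hallLittlewoodPoly n μ).IsHomogeneous (∑ i : Fin n, μ.rowLen i) := by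
  by_cases hμ : length μ ≤ n
  swap
  · rw [hallLittlewoodPoly_eq_zero hμ]
    exact isHomogeneous_zero _ _ _
  have hsub : ∀ p : Fin n × Fin n,
      (X p.1 - X p.2 : MvPolynomial (Fin n) (Polynomial ℤ)).IsHomogeneous 1 := fun p =>
    (isHomogeneous_X _ _).sub (isHomogeneous_X _ _)
  -- Divide the homogeneous right-hand side of `prod_sub_mul_hallLittlewoodPoly` by the product.
  refine isHomogeneous_of_mul (v := ∏ p : Fin n × Fin n with p.1 ≠ p.2, (X p.1 - X p.2))
    (m := ∑ p : Fin n × Fin n with p.1 ≠ p.2, 1) ?_ ?_ ?_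
  · exact Finset.prod_ne_zero_iff.2 fun p hp => sub_ne_zero' (Finset.mem_filter.1 hp).2
  · exact IsHomogeneous.prod _ _ _ fun p _ => hsub p
  · rw [prod_sub_mul_hallLittlewoodPoly hμ, add_comm]
    refine IsHomogeneous.sum _ _ _ fun f hf => ?_
    rw [← sum_eq_of_mem_rearr hf]
    refine (IsHomogeneous.prod _ _ _ fun i _ => isHomogeneous_X_pow _ _).mul
      (IsHomogeneous.prod _ _ _ fun p _ => ?_)
    split_ifs
    · exact (isHomogeneous_X _ _).sub (isHomogeneous_C_mul_X _ _)
    · exact hsub p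

end Homogeneous

/-! ### Finitely many variables -/

section KernelUniv

variable {ι A : Type*} [LinearOrder ι] [Fintype ι] [CommRing A]

theorem kernel_univ_mul {y : ι → A} {t : A} {q : ι → ι → A}
    (hq : ∀ i j, q i j * (1 - y i * y j) = 1) :
    kernel y t q Finset.univ *
        ((∏ i, (1 - y i ^ 2)) * ∏ p : ι × ι with p.1 < p.2, (1 - y p.1 * y p.2)) =
      ∏ p : ι × ι with p.1 < p.2, (1 - t * y p.1 * y p.2) := by
  have h1 : (∏ i, q i i) * ∏ i, (1 - y i ^ 2) = 1 := by
    rw [← Finset.prod_mul_distrib]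
    exact Finset.prod_eq_one fun i _ => by rw [sq, hq]
  have h2 : (∏ i, ∏ j with i < j, q i j * (1 - t * y i * y j)) =
      ∏ p : ι × ι with p.1 < p.2, q p.1 p.2 * (1 - t * y p.1 * y p.2) := by
    simp only [Finset.prod_filter, Fintype.prod_prod_type]
  have h3 : (∏ p : ι × ι with p.1 < p.2, q p.1 p.2 * (1 - t * y p.1 * y p.2)) *
      ∏ p : ι × ι with p.1 < p.2, (1 - y p.1 * y p.2) =
        ∏ p : ι × ι with p.1 < p.2, (1 - t * y p.1 * y p.2) := by
    rw [← Finset.prod_mul_distrib]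
    refine Finset.prod_congr rfl fun p _ => ?_
    linear_combination (1 - t * y p.1 * y p.2) * hq p.1 p.2
  rw [kernel, h2, mul_mul_mul_comm, h1, one_mul, h3]

end KernelUniv

section Finite

variable {n : ℕ}

open scoped Classical in
/-- The partitions of `d` with at most `n` parts. -/
noncomputable def parts (n d : ℕ) : Finset YoungDiagram :=
  (Finset.univ.piAntidiag d).image (toYoung (n := n))

theorem mem_parts {n d : ℕ} {μ : YoungDiagram} :
    μ ∈ parts n d ↔ length μ ≤ n ∧ ∑ i : Fin n, μ.rowLen i = d := by
  classical
  rw [parts, Finset.mem_image]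
  constructor
  · rintro ⟨f, hf, rfl⟩
    refine ⟨length_toYoung_le f, ?_⟩
    rw [← sum_eq_of_mem_rearr (mem_rearr_toYoung f)]
    exact (Finset.mem_piAntidiag.1 hf).1
  · rintro ⟨h1, h2⟩
    refine ⟨fun i => μ.rowLen i, by simpa using h2, ?_⟩
    exact (mem_rearr_iff_toYoung_eq h1).1 (mem_rearr.2 rfl)

/-- A vector `f` is a rearrangement of exactly one partition, namely `toYoung f`. -/
theorem sum_piAntidiag_eq_sum_parts (n d : ℕ) :
    ∑ f ∈ (Finset.univ : Finset (Fin n)).piAntidiag d,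
        weight (fun i => Polynomial.C (x i))
          (fun i j => Polynomial.C ((x i - tt n * x j) / (x i - x j))) 1 Polynomial.X Finset.univ f =
      ∑ μ ∈ parts n d, Polynomial.X ^ length (oddParts μ) *
        Polynomial.C (algebraMap _ (RatFun n) (hallLittlewoodPoly n μ)) := by
  classical
  rw [← Finset.sum_fiberwise_of_maps_to (t := parts n d) (g := toYoung)
    fun f hf => Finset.mem_image_of_mem _ hf]
  refine Finset.sum_congr rfl fun μ hμ => ?_
  obtain ⟨hμ, hd⟩ := mem_parts.1 hμ
  have hfib : (Finset.univ.piAntidiag d).filter (fun f : Fin n → ℕ => toYoung f = μ) =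
      rearr n μ := by
    ext f
    rw [Finset.mem_filter, mem_rearr_iff_toYoung_eq hμ, Finset.mem_piAntidiag,
      and_iff_right_iff_imp]
    intro hf
    refine ⟨?_, by simp⟩
    rw [← hd]
    exact sum_eq_of_mem_rearr ((mem_rearr_iff_toYoung_eq hμ).2 hf)
  rw [hfib, algebraMap_hallLittlewoodPoly, hallLittlewoodRat_eq n μ hμ, map_sum, Finset.mul_sum]
  refine Finset.sum_congr rfl fun f hf => ?_
  rw [weight, termOf, length_oddParts_of_mem_rearr hμ hf, mul_assoc, map_mul, map_prod, map_prod]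
  congr 1
  · rw [← Finset.prod_filter, Finset.prod_const]
  · congr 1
    · exact Finset.prod_congr rfl fun i _ => (map_pow _ _ _).symm
    · simp only [Finset.prod_filter, Fintype.prod_prod_type]

/-- The identity over `ℤ[t][x₁, …, xₙ]`, with an indeterminate in place of `a`, graded by the
substitution `x_i ↦ x_i u` and with the denominators on the right-hand side cleared. -/
theorem mk_sum_parts_mul (n : ℕ) :
    let y : Fin n → PowerSeries (Polynomial (MvPolynomial (Fin n) (Polynomial ℤ))) :=
      fun i => PowerSeries.C (Polynomial.C (MvPolynomial.X i)) * PowerSeries.X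
    (PowerSeries.mk fun d => ∑ μ ∈ parts n d,
        Polynomial.X ^ length (oddParts μ) * Polynomial.C (hallLittlewoodPoly n μ)) *
        ((∏ i, (1 - y i ^ 2)) * ∏ p : Fin n × Fin n with p.1 < p.2, (1 - y p.1 * y p.2)) =
      (∏ i, (1 + PowerSeries.C Polynomial.X * y i)) *
        ∏ p : Fin n × Fin n with p.1 < p.2,
          (1 - PowerSeries.C (Polynomial.C (MvPolynomial.C Polynomial.X)) * y p.1 * y p.2) := by
  intro y
  -- Over the rational functions the coefficients of the generating function are available.
  let φ : Polynomial (MvPolynomial (Fin n) (Polynomial ℤ)) →+* Polynomial (RatFun n) :=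
    Polynomial.mapRingHom (algebraMap _ _)
  have hφ : Function.Injective φ :=
    Polynomial.map_injective _ (IsFractionRing.injective _ _)
  apply PowerSeries.map_injective φ hφ
  let z : Fin n → PowerSeries (Polynomial (RatFun n)) :=
    fun i => PowerSeries.C (Polynomial.C (x i)) * PowerSeries.X
  have hy : ∀ i, PowerSeries.map φ (y i) = z i := fun i => by
    simp [y, z, φ, x]
  have hinj : Function.Injective fun i : Fin n => Polynomial.C (x i) :=
    Polynomial.C_injective.comp x_injective
  have hθ : ∀ i j : Fin n, i ≠ j → Polynomial.C ((x i - tt n * x j) / (x i - x j)) *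
      (Polynomial.C (x i) - Polynomial.C (x j)) =
        Polynomial.C (x i) - Polynomial.C (tt n) * Polynomial.C (x j) := by
    intro i j hij
    have h0 : x i - x j ≠ (0 : RatFun n) := sub_ne_zero.2 fun h => hij (x_injective h)
    rw [← map_sub, ← map_mul, ← map_mul, ← map_sub, div_mul_cancel₀ _ h0]
  have hq : ∀ i j, PowerSeries.invOfUnit (1 - z i * z j) 1 * (1 - z i * z j) = 1 := fun i j =>
    PowerSeries.invOfUnit_mul _ _ (by simp [z])
  have key := genFun_eq hinj hθ hq 1 Polynomial.X Finset.univ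
  have hgen : PowerSeries.map φ (PowerSeries.mk fun d => ∑ μ ∈ parts n d,
      Polynomial.X ^ length (oddParts μ) * Polynomial.C (hallLittlewoodPoly n μ)) =
      genFun (fun i => Polynomial.C (x i))
        (fun i j => Polynomial.C ((x i - tt n * x j) / (x i - x j))) 1 Polynomial.X Finset.univ := by
    ext1 d
    rw [PowerSeries.coeff_map, PowerSeries.coeff_mk, genFun, PowerSeries.coeff_mk,
      sum_piAntidiag_eq_sum_parts, map_sum]
    simp [φ]
  rw [map_mul, hgen, key]
  have hker := kernel_univ_mul (t := PowerSeries.C (Polynomial.C (tt n))) hq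
  simp only [map_mul, map_prod, map_sub, map_add, map_pow, hy, map_one]
  rw [mul_assoc, hker]
  simp [φ, tt, z]

end Finite

section FiniteVariables

variable {R : Type*} [CommRing R]

theorem singleFactor_mul {σ : Type*} (a : R) (i : σ) :
    singleFactor a i * (1 - MvPowerSeries.X i ^ 2) = 1 + MvPowerSeries.C a * MvPowerSeries.X i := by
  rw [singleFactor, mul_assoc, MvPowerSeries.invOfUnit_mul _ _ (by simp), mul_one]

theorem pairFactor_mul {σ : Type*} (t : R) (i j : σ) :
    pairFactor t i j * (1 - MvPowerSeries.X i * MvPowerSeries.X j) =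
      1 - MvPowerSeries.C t * MvPowerSeries.X i * MvPowerSeries.X j := by
  rw [pairFactor, mul_assoc, MvPowerSeries.invOfUnit_mul _ _ (by simp), mul_one]

/-- The identity over `R`, as an equality of homogeneous components. Since the denominators of the
product become units, it follows from `mk_sum_parts_mul` by specializing `a` and `t`. -/
theorem grading_prod_factors (a t : R) (n : ℕ) :
    grading (Fin n) R ((∏ i : Fin n, singleFactor a i) *
        ∏ p : Fin n × Fin n with p.1 < p.2, pairFactor t p.1 p.2) =
      PowerSeries.mk fun d => ∑ μ ∈ parts n d, MvPolynomial.C (a ^ length (oddParts μ)) *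
        MvPolynomial.map (Polynomial.eval₂RingHom (Int.castRingHom R) t)
          (hallLittlewoodPoly n μ) := by
  let D : MvPowerSeries (Fin n) R := (∏ i : Fin n, (1 - MvPowerSeries.X i ^ 2)) *
    ∏ p : Fin n × Fin n with p.1 < p.2, (1 - MvPowerSeries.X p.1 * MvPowerSeries.X p.2)
  have hD : IsUnit (grading (Fin n) R D) := by
    apply IsUnit.map
    rw [MvPowerSeries.isUnit_iff_constantCoeff]
    simp [D, map_prod]
  have h1 : ((∏ i : Fin n, singleFactor a i) *
        ∏ p : Fin n × Fin n with p.1 < p.2, pairFactor t p.1 p.2) * D =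
      (∏ i : Fin n, (1 + MvPowerSeries.C a * MvPowerSeries.X i)) *
        ∏ p : Fin n × Fin n with p.1 < p.2,
          (1 - MvPowerSeries.C t * MvPowerSeries.X p.1 * MvPowerSeries.X p.2) := by
    rw [mul_mul_mul_comm, ← Finset.prod_mul_distrib, ← Finset.prod_mul_distrib]
    simp only [singleFactor_mul, pairFactor_mul]
  let ψ : Polynomial (MvPolynomial (Fin n) (Polynomial ℤ)) →+* MvPolynomial (Fin n) R :=
    Polynomial.eval₂RingHom (MvPolynomial.map (Polynomial.eval₂RingHom (Int.castRingHom R) t))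
      (MvPolynomial.C a)
  have h2 := congrArg (PowerSeries.map ψ) (mk_sum_parts_mul n)
  have hmk : PowerSeries.map ψ (PowerSeries.mk fun d => ∑ μ ∈ parts n d,
      Polynomial.X ^ length (oddParts μ) * Polynomial.C (hallLittlewoodPoly n μ)) =
      PowerSeries.mk fun d => ∑ μ ∈ parts n d, MvPolynomial.C (a ^ length (oddParts μ)) *
        MvPolynomial.map (Polynomial.eval₂RingHom (Int.castRingHom R) t)
          (hallLittlewoodPoly n μ) := by
    ext1 d
    rw [PowerSeries.coeff_map, PowerSeries.coeff_mk, PowerSeries.coeff_mk, map_sum]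
    refine Finset.sum_congr rfl fun μ _ => ?_
    rw [map_mul]
    simp [ψ]
  rw [map_mul, hmk] at h2
  have h3 := congrArg (grading (Fin n) R) h1
  rw [map_mul] at h3
  refine hD.mul_right_cancel (h3.trans (Eq.trans ?_ (h2.symm.trans ?_)))
  · simp [ψ, map_prod, grading_X, grading_C]
  · congr 1
    simp [ψ, D, map_prod, grading_X]

theorem hasSum_PFin [TopologicalSpace R] (a t : R) (n : ℕ) :
    HasSum
      (fun μ : YoungDiagram => MvPowerSeries.C (a ^ length (oddParts μ)) * PFin t n μ)
      ((∏ i : Fin n, singleFactor a i) *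
        ∏ p : Fin n × Fin n with p.1 < p.2, pairFactor t p.1 p.2) := by
  rw [MvPowerSeries.WithPiTopology.hasSum_iff_hasSum_coeff]
  intro e
  have h := coeff_coeff_grading ((∏ i : Fin n, singleFactor a i) *
    ∏ p : Fin n × Fin n with p.1 < p.2, pairFactor t p.1 p.2) e.degree e
  rw [if_pos rfl, grading_prod_factors, PowerSeries.coeff_mk, MvPolynomial.coeff_sum] at h
  rw [← h]
  have hcoeff : ∀ μ : YoungDiagram,
      MvPowerSeries.coeff e (MvPowerSeries.C (a ^ length (oddParts μ)) * PFin t n μ) =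
        (MvPolynomial.C (a ^ length (oddParts μ)) *
          MvPolynomial.map (Polynomial.eval₂RingHom (Int.castRingHom R) t)
            (hallLittlewoodPoly n μ)).coeff e := fun μ => by
    rw [PFin, MvPowerSeries.coeff_C_mul, MvPolynomial.coeff_C_mul, MvPolynomial.coeff_coe]
  simp only [hcoeff]
  refine hasSum_sum_of_ne_finset_zero fun μ hμ => ?_
  rw [MvPolynomial.coeff_C_mul, MvPolynomial.coeff_map]
  have h0 : (hallLittlewoodPoly n μ).coeff e = 0 := by
    by_cases hl : length μ ≤ n
    · apply (isHomogeneous_hallLittlewoodPoly n μ).coeff_eq_zero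
      exact fun hd => hμ (mem_parts.2 ⟨hl, hd.symm⟩)
    · rw [hallLittlewoodPoly_eq_zero hl, MvPolynomial.coeff_zero]
  rw [h0, map_zero, mul_zero]

end FiniteVariables

/-! ### Infinitely many variables -/

section InfiniteVariables

variable {R : Type*} [CommRing R]

theorem le_weightedOrder_of_X_dvd {k : ℕ} {F : MvPowerSeries ℕ R} (h : MvPowerSeries.X k ∣ F) :
    (k : ℕ∞) ≤ F.weightedOrder id := by
  apply MvPowerSeries.nat_le_weightedOrder
  intro d hd
  apply MvPowerSeries.X_dvd_iff.1 h
  by_contra hdk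
  apply hd.not_ge
  rw [Finsupp.weight_apply, Finsupp.sum]
  calc k ≤ d k • id k := by
        simpa using Nat.le_mul_of_pos_left k (Nat.pos_of_ne_zero hdk)
    _ ≤ _ := Finset.single_le_sum (f := fun i => d i • id i) (fun _ _ => Nat.zero_le _)
        (Finsupp.mem_support_iff.2 hdk)

/-- Convergence is measured by the order in which `x_k` has weight `k`. The ordinary order does not
suffice, as all factors `1 + (1 - t) x_i x_j + ⋯` may differ from `1` in the same degree. -/
theorem multipliable_of_X_dvd [TopologicalSpace R] {ι : Type*} [Countable ι] [Infinite ι]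
    {f : ι → MvPowerSeries ℕ R} {k : ι → ℕ} (hk : Filter.Tendsto k Filter.cofinite Filter.atTop)
    (hf : ∀ i, MvPowerSeries.X (k i) ∣ f i - 1) : Multipliable f := by
  obtain ⟨_⟩ := nonempty_denumerable ι
  let e : ℕ ≃ ι := (Denumerable.eqv ι).symm
  rw [← e.multipliable_iff]
  have h : (f ∘ e) = fun m => 1 + (f (e m) - 1) := by
    funext m
    simp
  rw [h]
  apply MvPowerSeries.WithPiTopology.multipliable_one_add_of_tendsto_weightedOrder_atTop_nhds_top
    (w := id)
  rw [ENat.tendsto_nhds_top_iff_natCast_lt]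
  intro N
  have h1 : Filter.Tendsto (k ∘ e) Filter.atTop Filter.atTop := by
    rw [← Nat.cofinite_eq_atTop]
    exact (Nat.cofinite_eq_atTop ▸ hk).comp e.injective.tendsto_cofinite
  filter_upwards [h1.eventually_gt_atTop N] with m hm
  exact lt_of_lt_of_le (by exact_mod_cast hm) (le_weightedOrder_of_X_dvd (hf (e m)))

theorem multipliable_singleFactor [TopologicalSpace R] (a : R) :
    Multipliable fun i : ℕ => singleFactor a i := by
  refine multipliable_of_X_dvd (k := id) (Nat.cofinite_eq_atTop ▸ Filter.tendsto_id) fun i => ?_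
  refine ⟨(MvPowerSeries.C a + MvPowerSeries.X i) *
    MvPowerSeries.invOfUnit (1 - MvPowerSeries.X i ^ 2) 1, ?_⟩
  have h := MvPowerSeries.mul_invOfUnit (1 - MvPowerSeries.X i ^ 2 : MvPowerSeries ℕ R) 1 (by simp)
  rw [singleFactor, id]
  linear_combination h

theorem multipliable_pairFactor [TopologicalSpace R] (t : R) :
    Multipliable fun p : {p : ℕ × ℕ // p.1 < p.2} => pairFactor t p.1.1 p.1.2 := by
  have : Infinite {p : ℕ × ℕ // p.1 < p.2} :=
    Infinite.of_injective (fun i : ℕ => ⟨(i, i + 1), Nat.lt_succ_self i⟩) fun i j h =>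
      congrArg (fun p : {p : ℕ × ℕ // p.1 < p.2} => p.1.1) h
  refine multipliable_of_X_dvd (k := fun p => p.1.2) ?_ fun p => ?_
  · rw [Filter.tendsto_atTop]
    intro N
    refine Set.Finite.subset (Set.Finite.preimage Subtype.val_injective.injOn
      (Finset.range N ×ˢ Finset.range N).finite_toSet) fun p hp => ?_
    have h1 := p.2
    have h2 : p.1.2 < N := not_le.1 hp
    simp only [Set.mem_preimage, Finset.mem_coe, Finset.mem_product, Finset.mem_range]
    omega
  · refine ⟨(1 - MvPowerSeries.C t) * MvPowerSeries.X p.1.1 *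
      MvPowerSeries.invOfUnit (1 - MvPowerSeries.X p.1.1 * MvPowerSeries.X p.1.2) 1, ?_⟩
    have h := MvPowerSeries.mul_invOfUnit
      (1 - MvPowerSeries.X p.1.1 * MvPowerSeries.X p.1.2 : MvPowerSeries ℕ R) 1 (by simp)
    rw [pairFactor]
    linear_combination h

/-- Setting the variables `x_i` with `i ≥ n` to zero. -/
noncomputable def restrict (R : Type*) [CommRing R] (n : ℕ) :
    MvPowerSeries ℕ R →ₐ[R] MvPowerSeries (Fin n) R :=
  MvPowerSeries.killCompl Fin.valEmbedding

theorem coeff_restrict (n : ℕ) (F : MvPowerSeries ℕ R) (d : Fin n →₀ ℕ) :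
    MvPowerSeries.coeff d (restrict R n F) = MvPowerSeries.coeff (d.mapDomain Fin.val) F := by
  rw [restrict, MvPowerSeries.coeff_killCompl, Finsupp.embDomain_eq_mapDomain]
  rfl

theorem continuous_restrict [TopologicalSpace R] (n : ℕ) : Continuous (restrict R n) :=
  continuous_pi fun d => MvPowerSeries.WithPiTopology.continuous_coeff R
    (d.embDomain Fin.valEmbedding)

theorem restrict_X_of_lt {n i : ℕ} (h : i < n) :
    restrict R n (MvPowerSeries.X i) = MvPowerSeries.X ⟨i, h⟩ :=
  MvPowerSeries.killCompl_X (e := Fin.valEmbedding) (⟨i, h⟩ : Fin n)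

theorem restrict_X_of_le {n i : ℕ} (h : n ≤ i) : restrict R n (MvPowerSeries.X i) = 0 := by
  apply MvPowerSeries.killCompl_X_eq_zero
  rintro ⟨j, rfl⟩
  exact absurd j.isLt (not_lt.2 h)

theorem restrict_C (n : ℕ) (r : R) : restrict R n (MvPowerSeries.C r) = MvPowerSeries.C r :=
  MvPowerSeries.killCompl_C r

theorem restrict_singleFactor (n : ℕ) (a : R) (i : ℕ) : restrict R n (singleFactor a i) =
    if h : i < n then singleFactor a (⟨i, h⟩ : Fin n) else 1 := by
  have h1 := congrArg (restrict R n) (singleFactor_mul a i)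
  simp only [map_mul, map_sub, map_add, map_one, map_pow, restrict_C] at h1
  split_ifs with h
  · rw [restrict_X_of_lt h, ← singleFactor_mul] at h1
    refine IsUnit.mul_right_cancel ?_ h1
    rw [MvPowerSeries.isUnit_iff_constantCoeff]
    simp
  · simpa [restrict_X_of_le (not_lt.1 h)] using h1

theorem restrict_pairFactor (n : ℕ) (t : R) {i j : ℕ} (hij : i < j) :
    restrict R n (pairFactor t i j) =
      if h : j < n then pairFactor t (⟨i, hij.trans h⟩ : Fin n) ⟨j, h⟩ else 1 := by
  have h1 := congrArg (restrict R n) (pairFactor_mul t i j)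
  simp only [map_mul, map_sub, map_one, restrict_C] at h1
  split_ifs with h
  · rw [restrict_X_of_lt h, restrict_X_of_lt (hij.trans h), ← pairFactor_mul] at h1
    refine IsUnit.mul_right_cancel ?_ h1
    rw [MvPowerSeries.isUnit_iff_constantCoeff]
    simp
  · simpa [restrict_X_of_le (not_lt.1 h)] using h1

theorem restrict_PInf (n : ℕ) (t : R) (μ : YoungDiagram) :
    restrict R n (PInf t μ) = PFin t n μ := by
  ext d
  rw [coeff_restrict, PInf, MvPowerSeries.coeff_map, coeff_hallLittlewood, PFin,
    MvPolynomial.coeff_coe, MvPolynomial.coeff_map]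

theorem restrict_tprod [TopologicalSpace R] [T2Space R] (n : ℕ) (a t : R) :
    restrict R n ((∏' i : ℕ, singleFactor a i) *
        ∏' p : {p : ℕ × ℕ // p.1 < p.2}, pairFactor t p.1.1 p.1.2) =
      (∏ i : Fin n, singleFactor a i) *
        ∏ p : Fin n × Fin n with p.1 < p.2, pairFactor t p.1 p.2 := by
  rw [map_mul, (multipliable_singleFactor a).map_tprod _ (continuous_restrict n),
    (multipliable_pairFactor t).map_tprod _ (continuous_restrict n)]
  congr 1
  · rw [tprod_eq_prod (s := Finset.range n), Finset.prod_range]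
    · refine Finset.prod_congr rfl fun i _ => ?_
      rw [restrict_singleFactor, dif_pos i.isLt]
    · intro i hi
      rw [restrict_singleFactor, dif_neg (by simpa using hi)]
  · let e : {p : Fin n × Fin n // p.1 < p.2} ↪ {p : ℕ × ℕ // p.1 < p.2} :=
      ⟨fun p => ⟨(p.1.1, p.1.2), p.2⟩, fun p q h => by
        simp only [Subtype.mk.injEq, Prod.mk.injEq, Fin.val_inj] at h
        exact Subtype.ext (Prod.ext h.1 h.2)⟩
    rw [tprod_eq_prod (s := Finset.univ.map e), Finset.prod_map,
      ← Finset.prod_subtype_eq_prod_filter, Finset.subtype_univ]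
    · refine Finset.prod_congr rfl fun p _ => ?_
      rw [restrict_pairFactor n t (e p).2]
      exact dif_pos p.1.2.isLt
    · intro p hp
      rw [restrict_pairFactor n t p.2, dif_neg]
      intro h
      exact hp (Finset.mem_map.2 ⟨⟨(⟨p.1.1, p.2.trans h⟩, ⟨p.1.2, h⟩), p.2⟩, Finset.mem_univ _, rfl⟩)

theorem hasSum_PInf [TopologicalSpace R] [T2Space R] (a t : R) :
    HasSum
      (fun μ : YoungDiagram => MvPowerSeries.C (a ^ length (oddParts μ)) * PInf t μ)
      ((∏' i : ℕ, singleFactor a i) *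
        ∏' p : {p : ℕ × ℕ // p.1 < p.2}, pairFactor t p.1.1 p.1.2) := by
  rw [MvPowerSeries.WithPiTopology.hasSum_iff_hasSum_coeff]
  intro d
  -- A monomial only involves finitely many variables, so the remaining ones can be set to zero.
  obtain ⟨n, e, rfl⟩ : ∃ (n : ℕ) (e : Fin n →₀ ℕ), e.mapDomain Fin.val = d := by
    refine ⟨d.support.sup id + 1, d.comapDomain Fin.val Fin.val_injective.injOn, ?_⟩
    refine Finsupp.mapDomain_comapDomain _ Fin.val_injective _ fun i hi => ?_
    exact ⟨⟨i, Nat.lt_succ_of_le (Finset.le_sup (f := id) hi)⟩, rfl⟩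
  simp only [← coeff_restrict, map_mul, restrict_C, restrict_PInf]
  rw [← map_mul, restrict_tprod]
  exact MvPowerSeries.WithPiTopology.hasSum_iff_hasSum_coeff.1 (hasSum_PFin a t n) e

end InfiniteVariables
end HallLittlewood

theorem mainTheorem2 {R : Type*} [CommRing R] [TopologicalSpace R] [DiscreteTopology R] (a t : R) :
    (∀ n : ℕ,
      HasSum
        (fun μ : YoungDiagram =>
          MvPowerSeries.C (a ^ HallLittlewood.length (HallLittlewood.oddParts μ)) *
            HallLittlewood.PFin t n μ)
        ((∏ i : Fin n, HallLittlewood.singleFactor a i) *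
          ∏ p : Fin n × Fin n with p.1 < p.2, HallLittlewood.pairFactor t p.1 p.2)) ∧
    (Multipliable fun i : ℕ => HallLittlewood.singleFactor a i) ∧
    (Multipliable fun p : {p : ℕ × ℕ // p.1 < p.2} =>
      HallLittlewood.pairFactor t p.1.1 p.1.2) ∧
    HasSum
      (fun μ : YoungDiagram =>
        MvPowerSeries.C (a ^ HallLittlewood.length (HallLittlewood.oddParts μ)) *
          HallLittlewood.PInf t μ)
      ((∏' i : ℕ, HallLittlewood.singleFactor a i) *
        ∏' p : {p : ℕ × ℕ // p.1 < p.2}, HallLittlewood.pairFactor t p.1.1 p.1.2) :=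
  ⟨HallLittlewood.hasSum_PFin a t, HallLittlewood.multipliable_singleFactor a,
    HallLittlewood.multipliable_pairFactor t, HallLittlewood.hasSum_PInf a t⟩
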